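/- Let $k$ be an algebraically closed field of characteristic $0$, let $n\ge 2$ be an integer, and let $\mathcal A=\{a_{ij}\mid 1\le i<j\le n\}$ be any family of elements of $k$. Let $V_n(\mathcal A)$ be the associative unital $k$-algebra generated by $x_1,\dots,x_n$ subject to the relations $x_ix_j+x_jx_i=a_{ij}$ for all $1\le i<j\le n$, and let $W_n$ denote the algebra $V_n(\mathcal A)$ with $a_{ij}=1$ for all $i<j$. Write $\operatorname{Aut}(V_n(\mathcal A))$ for the group of $k$-algebra automorphisms of $V_n(\mathcal A)$. If $\operatorname{Aut}(V_n(\mathcal A))$ is finite of order $2\cdot n!$, then $n$ is even, $n\ge 4$, $V_n(\mathcal A)$ is isomorphic to $W_n$ as a $k$-algebra, and $\operatorname{Aut}(V_n(\mathcal A))$ is isomorphic as a group to $S_n\times\{\pm1\}$. -/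

import Mathlib

open scoped Nat

/-- The defining relations `x i * x j + x j * x i = a i j`, for `i < j`, on the free algebra
`k⟨x 0, …, x (n-1)⟩`. Only the scalars `a i j` with `i < j` are used. -/
inductive ModifiedQuantumWeylRel (k : Type*) [CommRing k] (n : ℕ) (a : Fin n → Fin n → k) :
    FreeAlgebra k (Fin n) → FreeAlgebra k (Fin n) → Prop
  | anticomm (i j : Fin n) (hij : i < j) :
      ModifiedQuantumWeylRel k n a
        (FreeAlgebra.ι k i * FreeAlgebra.ι k j + FreeAlgebra.ι k j * FreeAlgebra.ι k i)
        (algebraMap k (FreeAlgebra k (Fin n)) (a i j))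

/-- The modified `(-1)`-quantum Weyl algebra: the `k`-algebra generated by `n` elements `x i`
subject to the relations `x i * x j + x j * x i = a i j` for `i < j`. -/
abbrev ModifiedQuantumWeylAlgebra (k : Type*) [CommRing k] (n : ℕ) (a : Fin n → Fin n → k) :=
  RingQuot (ModifiedQuantumWeylRel k n a)

/-- The `(-1)`-quantum Weyl algebra: all the scalars are equal to `1`. -/
abbrev QuantumWeylAlgebra (k : Type*) [CommRing k] (n : ℕ) :=
  ModifiedQuantumWeylAlgebra k n (fun _ _ => 1)

/-! Write `c i j` for the symmetric extension of the scalars. The ordered monomials in the `x i`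
form a basis, and the product of two of them is, up to sign, the monomial with the sum of the
exponents plus monomials that strictly divide it. Each `x i ^ 2` is central.

If `n` is odd, iterated twisted commutators of the first `n - 1` generators give a nonzero `y` that
anticommutes with all of them. The maps `x n ↦ x n + t y`, with the other generators fixed, are then
infinitely many automorphisms, so `n` must be even.

If `n` is even, the center is the polynomial ring in the `X i = x i ^ 2`, over which the algebra is
free of rank `2 ^ n`. The discriminant of its trace form has a dominating monomial that involves
every `X i`. An automorphism preserves the discriminant up to a unit, and comparing degrees shows
that the image of each `X i` has degree 1. So the image of `x i` is a linear form, and the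
anticommutators force it to be a multiple of one generator (`exists_perm_of_even`). Automorphisms
are therefore the pairs `(σ, r)` with `r i * r j * c (σ i) (σ j) = c i j`.

The rest is counting. If the group is finite, the rescalings (`σ = 1`) have values `±1`. Call two
indices equivalent if every rescaling takes the same value on both; every class has at least three
elements, since otherwise there is a one-parameter family of rescalings. With `d` classes there are
at most `2 ^ d` rescalings, and the set `H` of permutations that occur satisfies `|H| * d! ^ 2 ≤
n!`. Order `2 * n!` leaves only `d ≤ 1`, and then every permutation occurs
(`exists_rescales_of_card`). A family `c` with this symmetry has the form `s i * s j`, so rescaling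
gives `W_n`. There the signed permutations with constant sign already make up `2 * n!`
automorphisms. -/

namespace ModifiedQuantumWeylAlgebra

/-! ### Creation and annihilation operators on the space of exponents -/

section Normal

variable {k : Type*} [Field k] {n : ℕ}

/-- The sign picked up by moving a generator past the variables of index less than `i`. -/
def belowSign (k : Type*) [Field k] (i : Fin n) (e : Fin n →₀ ℕ) : k :=
  (-1) ^ (∑ l ∈ Finset.Iio i, e l)

lemma belowSign_mul_self (i : Fin n) (e : Fin n →₀ ℕ) :
    belowSign k i e * belowSign k i e = 1 := by
  rw [belowSign, ← mul_pow]; simp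

lemma belowSign_ne_zero (i : Fin n) (e : Fin n →₀ ℕ) : belowSign k i e ≠ 0 := fun h => by
  simpa [h] using belowSign_mul_self (k := k) i e

lemma belowSign_add (i : Fin n) (e f : Fin n →₀ ℕ) :
    belowSign k i (e + f) = belowSign k i e * belowSign k i f := by
  simp [belowSign, Finset.sum_add_distrib, pow_add]

lemma belowSign_single (i j : Fin n) (p : ℕ) :
    belowSign k i (Finsupp.single j p) = if j < i then (-1) ^ p else 1 := by
  simp only [belowSign, Finsupp.single_apply, Finset.sum_ite_eq, Finset.mem_Iio]
  split_ifs <;> simp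

lemma belowSign_sub (i j : Fin n) (e : Fin n →₀ ℕ) (h : e j ≠ 0) :
    belowSign k i (e - Finsupp.single j 1) = belowSign k i e * if j < i then -1 else 1 := by
  have h1 : Finsupp.single j 1 ≤ e := by
    rw [Finsupp.single_le_iff]; omega
  have h2 := belowSign_add (k := k) i (e - Finsupp.single j 1) (Finsupp.single j 1)
  rw [tsub_add_cancel_of_le h1, belowSign_single] at h2
  rw [h2]
  split_ifs <;> simp

/-- The space on which the algebra acts, with a basis indexed by exponents of ordered monomials. -/
abbrev NormalSpace (k : Type*) [Field k] (n : ℕ) := (Fin n →₀ ℕ) →₀ k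

/-- The creation operators. -/
noncomputable def raiseOp (i : Fin n) : NormalSpace k n →ₗ[k] NormalSpace k n :=
  Finsupp.linearCombination k fun e =>
    Finsupp.single (e + Finsupp.single i 1) (belowSign k i e)

/-- The annihilation operators. -/
noncomputable def lowerOp (i : Fin n) : NormalSpace k n →ₗ[k] NormalSpace k n :=
  Finsupp.linearCombination k fun e =>
    if Odd (e i) then Finsupp.single (e - Finsupp.single i 1) (belowSign k i e) else 0

lemma raiseOp_single (i : Fin n) (e : Fin n →₀ ℕ) (c : k) :
    raiseOp i (Finsupp.single e c) =
      Finsupp.single (e + Finsupp.single i 1) (c * belowSign k i e) := by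
  simp [raiseOp]

lemma lowerOp_single (i : Fin n) (e : Fin n →₀ ℕ) (c : k) :
    lowerOp i (Finsupp.single e c) =
      if Odd (e i) then Finsupp.single (e - Finsupp.single i 1) (c * belowSign k i e) else 0 := by
  simp [lowerOp]

/-- Of the two orders, exactly one picks up an extra sign, from raising the smaller index first. The
case `i = j` is excluded: `x i ^ 2` is not prescribed by the relations. -/
lemma raiseOp_anticomm {i j : Fin n} (hij : i ≠ j) (p : NormalSpace k n) :
    raiseOp i (raiseOp j p) + raiseOp j (raiseOp i p) = 0 := by
  induction p using Finsupp.induction_linear with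
  | zero => simp
  | add p q hp hq =>
    simp only [map_add]
    rw [add_add_add_comm, hp, hq, add_zero]
  | single e c =>
    simp only [raiseOp_single, belowSign_add, belowSign_single]
    rw [add_right_comm, ← Finsupp.single_add]
    rcases lt_or_gt_of_ne hij with h | h
    · simp [h, not_lt_of_ge h.le, -Finsupp.single_mul, mul_right_comm]
    · simp [h, not_lt_of_ge h.le, -Finsupp.single_mul, mul_right_comm]

lemma lowerOp_anticomm (i j : Fin n) (p : NormalSpace k n) :
    lowerOp i (lowerOp j p) + lowerOp j (lowerOp i p) = 0 := by
  induction p using Finsupp.induction_linear with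
  | zero => simp
  | add p q hp hq =>
    simp only [map_add]
    rw [add_add_add_comm, hp, hq, add_zero]
  | single e c =>
    rcases eq_or_ne i j with rfl | hij
    · by_cases h : Odd (e i)
      · have : ¬ Odd (e i - 1) := by
          rw [Nat.not_odd_iff_even]; exact Nat.Odd.sub_odd h odd_one
        simp [lowerOp_single, -Finsupp.single_mul, h, this]
      · simp [lowerOp_single, -Finsupp.single_mul, h]
    · by_cases h : Odd (e i)
      · by_cases h' : Odd (e j)
        · have hi : (e - Finsupp.single j 1 : Fin n →₀ ℕ) i = e i := by simp [hij.symm]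
          have hj : (e - Finsupp.single i 1 : Fin n →₀ ℕ) j = e j := by simp [hij]
          simp only [lowerOp_single, h, h', if_true, hi, hj, belowSign_sub _ _ _ h.pos.ne',
            belowSign_sub _ _ _ h'.pos.ne']
          rw [tsub_right_comm, ← Finsupp.single_add]
          rcases lt_or_gt_of_ne hij with h | h
          · simp [h, not_lt_of_ge h.le, -Finsupp.single_mul, mul_right_comm]
          · simp [h, not_lt_of_ge h.le, -Finsupp.single_mul, mul_right_comm]
        · simp [lowerOp_single, -Finsupp.single_mul, h, h', hij]
      · simp [lowerOp_single, -Finsupp.single_mul, h]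
        split_ifs <;> simp [lowerOp_single, -Finsupp.single_mul, h, hij.symm]

/-- For `i = j` the parity of `e i` decides which of the two terms is the identity; the other
vanishes. This is why `lowerOp` acts only on odd exponents. -/
lemma raiseOp_lowerOp (i j : Fin n) (p : NormalSpace k n) :
    raiseOp i (lowerOp j p) + lowerOp j (raiseOp i p) = if i = j then p else 0 := by
  induction p using Finsupp.induction_linear with
  | zero => simp
  | add p q hp hq =>
    simp only [map_add]
    rw [add_add_add_comm, hp, hq]
    split_ifs <;> simp
  | single e c =>
    rcases eq_or_ne i j with rfl | hij
    · by_cases h : Odd (e i)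
      · have h1 : Finsupp.single i 1 ≤ e := by
          rw [Finsupp.single_le_iff]; have := h.pos; omega
        have : ¬ Odd (e i + 1) := by
          rw [Nat.not_odd_iff_even]; exact h.add_one
        simp [lowerOp_single, raiseOp_single, -Finsupp.single_mul, h, this, belowSign_sub _ _ _ h.pos.ne',
          tsub_add_cancel_of_le h1, mul_assoc, belowSign_mul_self]
      · have : Odd (e i + 1) := by
          rw [Nat.not_odd_iff_even] at h; exact h.add_one
        simp [lowerOp_single, raiseOp_single, -Finsupp.single_mul, h, this, belowSign_add, belowSign_single,
          mul_assoc, belowSign_mul_self]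
    · by_cases h : Odd (e j)
      · have h1 : Finsupp.single j 1 ≤ e := by
          rw [Finsupp.single_le_iff]; have := h.pos; omega
        have hj : (e + Finsupp.single i 1 : Fin n →₀ ℕ) j = e j := by simp [hij]
        simp only [lowerOp_single, raiseOp_single, h, hj, if_true, belowSign_add,
          belowSign_sub _ _ _ h.pos.ne', belowSign_single]
        rw [tsub_add_eq_add_tsub h1, ← Finsupp.single_add, if_neg hij]
        rcases lt_or_gt_of_ne hij with h | h
        · simp [h, not_lt_of_ge h.le, -Finsupp.single_mul, mul_right_comm]
        · simp [h, not_lt_of_ge h.le, -Finsupp.single_mul, mul_right_comm]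
      · simp [lowerOp_single, raiseOp_single, -Finsupp.single_mul, h, hij]

end Normal

/-! ### Generators, relations and the universal property -/

section Presentation

variable {k : Type*} [CommRing k] {n : ℕ} (a : Fin n → Fin n → k)

/-- A type synonym of `ModifiedQuantumWeylAlgebra k n a` whose ring structure is not unfolded. -/
def QuantumWeyl : Type _ := ModifiedQuantumWeylAlgebra k n a

noncomputable instance : Ring (QuantumWeyl a) :=
  inferInstanceAs (Ring (ModifiedQuantumWeylAlgebra k n a))

noncomputable instance : Algebra k (QuantumWeyl a) :=
  inferInstanceAs (Algebra k (ModifiedQuantumWeylAlgebra k n a))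

/-- The identification of the type synonym with the algebra. -/
noncomputable def ofQuantumWeyl : QuantumWeyl a ≃ₐ[k] ModifiedQuantumWeylAlgebra k n a :=
  AlgEquiv.refl

/-- The generators. -/
noncomputable def gen (i : Fin n) : QuantumWeyl a :=
  (ofQuantumWeyl a).symm
    (RingQuot.mkAlgHom k (ModifiedQuantumWeylRel k n a) (FreeAlgebra.ι k i))

/-- The symmetric extension of the family of scalars. -/
def sym (i j : Fin n) : k := if i < j then a i j else a j i

omit [CommRing k] in
lemma sym_comm {i j : Fin n} (h : i ≠ j) : sym a i j = sym a j i := by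
  rcases lt_or_gt_of_ne h with h | h <;> simp [sym, h, not_lt_of_ge h.le]

lemma gen_mul_gen_add {i j : Fin n} (h : i ≠ j) :
    gen a i * gen a j + gen a j * gen a i = algebraMap k _ (sym a i j) := by
  have key : ∀ i j : Fin n, i < j →
      gen a i * gen a j + gen a j * gen a i = algebraMap k _ (a i j) := by
    intro i j hij
    have := congrArg (ofQuantumWeyl a).symm
      (RingQuot.mkAlgHom_rel k (ModifiedQuantumWeylRel.anticomm (a := a) i j hij))
    simpa only [gen, map_add, map_mul, AlgHom.commutes, AlgEquiv.commutes] using this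
  rcases lt_or_gt_of_ne h with h | h
  · simp [sym, h, key i j h]
  · rw [add_comm]; simp [sym, not_lt_of_ge h.le, key j i h]

lemma gen_mul_gen {i j : Fin n} (h : i ≠ j) :
    gen a i * gen a j = algebraMap k _ (sym a i j) - gen a j * gen a i :=
  eq_sub_of_add_eq (gen_mul_gen_add a h)

variable {a}

/-- The universal property. -/
noncomputable def lift {A : Type*} [Ring A] [Algebra k A] (f : Fin n → A)
    (hf : ∀ i j, i ≠ j → f i * f j + f j * f i = algebraMap k A (sym a i j)) :
    QuantumWeyl a →ₐ[k] A :=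
  AlgHom.comp (RingQuot.liftAlgHom k ⟨FreeAlgebra.lift k f, by
    rintro _ _ ⟨i, j, hij⟩
    simpa [sym, hij] using hf i j hij.ne⟩) (ofQuantumWeyl a).toAlgHom

@[simp] lemma lift_gen {A : Type*} [Ring A] [Algebra k A] (f : Fin n → A)
    (hf : ∀ i j, i ≠ j → f i * f j + f j * f i = algebraMap k A (sym a i j)) (i : Fin n) :
    lift f hf (gen a i) = f i := by
  simp [lift, gen]

lemma algHom_ext {A : Type*} [Ring A] [Algebra k A]
    {f g : QuantumWeyl a →ₐ[k] A} (h : ∀ i, f (gen a i) = g (gen a i)) :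
    f = g := by
  have : f.comp (ofQuantumWeyl a).symm.toAlgHom = g.comp (ofQuantumWeyl a).symm.toAlgHom := by
    apply RingQuot.ringQuot_ext'
    apply FreeAlgebra.hom_ext
    funext i
    exact h i
  ext v
  simpa using DFunLike.congr_fun this (ofQuantumWeyl a v)

lemma algEquiv_ext {A : Type*} [Ring A] [Algebra k A]
    {f g : QuantumWeyl a ≃ₐ[k] A} (h : ∀ i, f (gen a i) = g (gen a i)) :
    f = g :=
  AlgEquiv.coe_toAlgHom_injective (algHom_ext h)

variable (a) in
lemma adjoin_gen : Algebra.adjoin k (Set.range (gen a)) = ⊤ := by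
  let π : FreeAlgebra k (Fin n) →ₐ[k] QuantumWeyl a :=
    AlgHom.comp (ofQuantumWeyl a).symm.toAlgHom (RingQuot.mkAlgHom k (ModifiedQuantumWeylRel k n a))
  have hπ : Function.Surjective π :=
    (ofQuantumWeyl a).symm.surjective.comp (RingQuot.mkAlgHom_surjective k _)
  have h1 := congrArg (Subalgebra.map π) (FreeAlgebra.adjoin_range_ι k (Fin n))
  rw [AlgHom.map_adjoin, ← Set.range_comp, Algebra.map_top, (AlgHom.range_eq_top π).2 hπ] at h1
  exact h1

end Presentation

end ModifiedQuantumWeylAlgebra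

namespace ModifiedQuantumWeylAlgebra

/-! ### A representation that separates the ordered monomials -/

section Representation

variable {k : Type*} [Field k] {n : ℕ} (a : Fin n → Fin n → k)

/-- The anticommutator of two combinations of operators that satisfy the canonical anticommutation
relations. -/
lemma anticomm_of_canonical {M : Type*} [AddCommGroup M] [Module k M] (R L : Fin n → M →ₗ[k] M)
    (hR : ∀ i j, i ≠ j → ∀ q, R i (R j q) + R j (R i q) = 0)
    (hL : ∀ i j q, L i (L j q) + L j (L i q) = 0)
    (hRL : ∀ i j q, R i (L j q) + L j (R i q) = if i = j then q else 0)
    {i j : Fin n} (hij : i ≠ j) :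
    (R i + ∑ l ∈ Finset.Iio i, sym a i l • L l) * (R j + ∑ l ∈ Finset.Iio j, sym a j l • L l)
      + (R j + ∑ l ∈ Finset.Iio j, sym a j l • L l) * (R i + ∑ l ∈ Finset.Iio i, sym a i l • L l)
      = algebraMap k (Module.End k M) (sym a i j) := by
  refine LinearMap.ext fun q => ?_
  have expand : ∀ i j : Fin n,
      ((R i + ∑ l ∈ Finset.Iio i, sym a i l • L l) * (R j + ∑ l ∈ Finset.Iio j, sym a j l • L l) :
        Module.End k M) q = R i (R j q)
      + ∑ m ∈ Finset.Iio j, sym a j m • R i (L m q)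
      + ∑ l ∈ Finset.Iio i, sym a i l • L l (R j q)
      + ∑ m ∈ Finset.Iio j, ∑ l ∈ Finset.Iio i, (sym a j m * sym a i l) • L l (L m q) := by
    intro i j
    simp only [Module.End.mul_apply, LinearMap.add_apply, LinearMap.sum_apply,
      LinearMap.smul_apply, map_add, map_sum, map_smul, Finset.sum_add_distrib, smul_add,
      Finset.smul_sum, smul_smul]
    abel
  -- Since the sum in `genOp j` runs over indices below `j`, only one of the two mixed
  -- anticommutators produces the scalar.
  have cross : ∀ i j : Fin n, ∑ m ∈ Finset.Iio j, sym a j m • R i (L m q)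
      + ∑ m ∈ Finset.Iio j, sym a j m • L m (R i q) = if i < j then sym a j i • q else 0 := by
    intro i j
    rw [← Finset.sum_add_distrib]
    simp only [← smul_add, hRL]
    simp
  have double : ∑ m ∈ Finset.Iio j, ∑ l ∈ Finset.Iio i, (sym a j m * sym a i l) • L l (L m q)
      + ∑ m ∈ Finset.Iio i, ∑ l ∈ Finset.Iio j, (sym a i m * sym a j l) • L l (L m q) = 0 := by
    rw [Finset.sum_comm (s := Finset.Iio i), ← Finset.sum_add_distrib]
    refine Finset.sum_eq_zero fun m _ => ?_
    rw [← Finset.sum_add_distrib]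
    refine Finset.sum_eq_zero fun l _ => ?_
    rw [mul_comm (sym a i l), ← smul_add, hL, smul_zero]
  have h3 := hR i j hij q
  have h4 : sym a i j • q = (if i < j then sym a j i • q else 0)
      + (if j < i then sym a i j • q else 0) := by
    rcases lt_or_gt_of_ne hij with h | h
    · simp [h, not_lt_of_ge h.le, sym_comm a hij]
    · simp [h, not_lt_of_ge h.le]
  rw [LinearMap.add_apply, expand, expand, Module.algebraMap_end_apply, h4, ← cross i j,
    ← cross j i, eq_neg_of_add_eq_zero_left h3, eq_neg_of_add_eq_zero_left double]
  abel

/-- The operator by which a generator acts on `NormalSpace k n`. -/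
noncomputable def genOp (i : Fin n) : Module.End k (NormalSpace k n) :=
  raiseOp i + ∑ j ∈ Finset.Iio i, sym a i j • lowerOp j

lemma genOp_apply (i : Fin n) (p : NormalSpace k n) :
    genOp a i p = raiseOp i p + ∑ j ∈ Finset.Iio i, sym a i j • lowerOp j p := by
  simp [genOp]

lemma genOp_anticomm {i j : Fin n} (hij : i ≠ j) :
    genOp a i * genOp a j + genOp a j * genOp a i = algebraMap k _ (sym a i j) :=
  anticomm_of_canonical a raiseOp lowerOp (fun _ _ h q => raiseOp_anticomm h q)
    lowerOp_anticomm raiseOp_lowerOp hij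

/-- The action on `NormalSpace k n`. -/
noncomputable def rep : QuantumWeyl a →ₐ[k] Module.End k (NormalSpace k n) :=
  lift (genOp a) fun _ _ h => genOp_anticomm a h

@[simp] lemma rep_gen (i : Fin n) : rep a (gen a i) = genOp a i := by simp [rep]

/-- The coordinates of an element with respect to the ordered monomials. -/
noncomputable def normalForm : QuantumWeyl a →ₗ[k] NormalSpace k n :=
  (LinearMap.applyₗ (Finsupp.single 0 1)).comp (rep a).toLinearMap

lemma normalForm_apply (v : QuantumWeyl a) :
    normalForm a v = rep a v (Finsupp.single 0 1) := rfl

lemma normalForm_mul (u v : QuantumWeyl a) :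
    normalForm a (u * v) = rep a u (normalForm a v) := by
  simp [normalForm_apply]

/-- The monomial in the variables from the list `l`, taken in the order of the list. -/
noncomputable def listMonomial (l : List (Fin n)) (e : Fin n →₀ ℕ) :
    QuantumWeyl a :=
  (l.map fun j => gen a j ^ e j).prod

/-- The ordered monomials. -/
noncomputable def orderedMonomial (e : Fin n →₀ ℕ) : QuantumWeyl a :=
  listMonomial a (List.finRange n) e

/-- The restriction of an exponent to the variables from the list `l`. -/
noncomputable def listExponent (l : List (Fin n)) (e : Fin n →₀ ℕ) : Fin n →₀ ℕ :=
  (l.map fun j => Finsupp.single j (e j)).sum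

lemma listMonomial_cons (j : Fin n) (l : List (Fin n)) (e : Fin n →₀ ℕ) :
    listMonomial a (j :: l) e = gen a j ^ e j * listMonomial a l e := by
  simp [listMonomial]

lemma listExponent_cons (j : Fin n) (l : List (Fin n)) (e : Fin n →₀ ℕ) :
    listExponent (j :: l) e = Finsupp.single j (e j) + listExponent l e := by
  simp [listExponent]

lemma listExponent_apply_eq_zero {l : List (Fin n)} {i : Fin n} (h : i ∉ l) (e : Fin n →₀ ℕ) :
    listExponent l e i = 0 := by
  induction l with
  | nil => simp [listExponent]
  | cons j l ih =>
    simp only [List.mem_cons, not_or] at h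
    rw [listExponent_cons, Finsupp.add_apply, ih h.2, Finsupp.single_eq_of_ne h.1]

lemma listExponent_finRange (e : Fin n →₀ ℕ) : listExponent (List.finRange n) e = e := by
  rw [listExponent, ← List.ofFn_eq_map, List.sum_ofFn]
  exact Finsupp.univ_sum_single e

/-- All annihilation terms of `genOp i` concern variables below `i`, which are absent here. Hence
ordered monomials applied to the vacuum `Finsupp.single 0 1` give distinct basis vectors. -/
lemma genOp_single (i : Fin n) (e : Fin n →₀ ℕ) (h : ∀ l < i, e l = 0) :
    genOp a i (Finsupp.single e 1) = Finsupp.single (e + Finsupp.single i 1) 1 := by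
  have h1 : belowSign k i e = 1 := by
    rw [belowSign, Finset.sum_eq_zero fun l hl => h l (Finset.mem_Iio.1 hl), pow_zero]
  rw [genOp_apply, raiseOp_single, h1, Finset.sum_eq_zero, add_zero, mul_one]
  intro l hl
  simp [lowerOp_single, h l (Finset.mem_Iio.1 hl)]

lemma genOp_pow_single (i : Fin n) (m : ℕ) (e : Fin n →₀ ℕ) (h : ∀ l < i, e l = 0) :
    (genOp a i ^ m) (Finsupp.single e 1) = Finsupp.single (e + Finsupp.single i m) 1 := by
  induction m with
  | zero => simp
  | succ m ih =>
    rw [pow_succ', Module.End.mul_apply, ih, genOp_single, add_assoc, ← Finsupp.single_add]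
    intro l hl
    simp [h l hl, Finsupp.single_eq_of_ne hl.ne]

lemma normalForm_listMonomial {l : List (Fin n)} (hl : l.Pairwise (· < ·)) (e : Fin n →₀ ℕ) :
    normalForm a (listMonomial a l e) = Finsupp.single (listExponent l e) 1 := by
  induction l with
  | nil => simp [listMonomial, listExponent, normalForm_apply]
  | cons j l ih =>
    rw [List.pairwise_cons] at hl
    rw [listMonomial_cons, normalForm_mul, ih hl.2, map_pow, rep_gen, genOp_pow_single,
      listExponent_cons, add_comm]
    intro i hi
    refine listExponent_apply_eq_zero (fun h => ?_) e
    exact absurd (hl.1 i h) (not_lt_of_ge hi.le)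

@[simp] lemma normalForm_orderedMonomial (e : Fin n →₀ ℕ) :
    normalForm a (orderedMonomial a e) = Finsupp.single e 1 := by
  rw [orderedMonomial, normalForm_listMonomial a (List.pairwise_lt_finRange n),
    listExponent_finRange]

end Representation

/-! ### The ordered monomials span -/

section Spanning

variable {k : Type*} [Field k] {n : ℕ} (a : Fin n → Fin n → k)

/-- Here `q` is `p` with `x j` replaced by `-x j`, and `r` is a skew derivative of `p`. -/
lemma exists_gen_mul_eq {i j : Fin n} (hij : i ≠ j) {p : QuantumWeyl a}
    (hp : p ∈ Algebra.adjoin k {gen a j}) :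
    ∃ q ∈ Algebra.adjoin k {gen a j}, ∃ r ∈ Algebra.adjoin k {gen a j},
      gen a i * p = q * gen a i + r := by
  induction hp using Algebra.adjoin_induction with
  | mem x hx =>
    rw [Set.mem_singleton_iff] at hx
    subst hx
    refine ⟨-gen a j, neg_mem (Algebra.self_mem_adjoin_singleton k _), _,
      algebraMap_mem _ (sym a i j), ?_⟩
    rw [gen_mul_gen a hij, neg_mul, sub_eq_neg_add]
  | algebraMap c =>
    exact ⟨_, algebraMap_mem _ c, 0, zero_mem _, by rw [add_zero, Algebra.commutes]⟩
  | add x y _ _ hx hy =>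
    obtain ⟨q, hq, r, hr, h⟩ := hx
    obtain ⟨q', hq', r', hr', h'⟩ := hy
    exact ⟨_, add_mem hq hq', _, add_mem hr hr', by rw [mul_add, h, h']; noncomm_ring⟩
  | mul x y _ hy' hx hy =>
    obtain ⟨q, hq, r, hr, h⟩ := hx
    obtain ⟨q', hq', r', hr', h'⟩ := hy
    exact ⟨_, mul_mem hq hq', _, add_mem (mul_mem hq hr') (mul_mem hr hy'), by
      rw [← mul_assoc, h, add_mul, mul_assoc q, h']; noncomm_ring⟩

/-- The products of polynomials in the single variables, taken in the order of the list. -/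
noncomputable def listSpan (l : List (Fin n)) : Submodule k (QuantumWeyl a) :=
  (l.map fun j => Subalgebra.toSubmodule (Algebra.adjoin k {gen a j})).prod

lemma gen_mul_mem_listSpan {l : List (Fin n)} {i : Fin n} (hi : i ∈ l)
    {y : QuantumWeyl a} (hy : y ∈ listSpan a l) :
    gen a i * y ∈ listSpan a l := by
  induction l generalizing y with
  | nil => simp at hi
  | cons j l ih =>
    rw [listSpan, List.map_cons, List.prod_cons] at hy ⊢
    induction hy using Submodule.mul_induction_on' with
    | mem_mul_mem p hp m hm =>
      rcases eq_or_ne i j with rfl | hij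
      · rw [← mul_assoc]
        exact Submodule.mul_mem_mul (Subalgebra.mul_mem _ (Algebra.self_mem_adjoin_singleton k _) hp) hm
      · obtain ⟨q, hq, r, hr, h⟩ := exists_gen_mul_eq a hij hp
        rw [← mul_assoc, h, add_mul, mul_assoc]
        exact add_mem (Submodule.mul_mem_mul hq (ih ((List.mem_cons.1 hi).resolve_left hij) hm))
          (Submodule.mul_mem_mul hr hm)
    | add x _ y _ hx hy =>
      rw [mul_add]
      exact add_mem hx hy

lemma listSpan_finRange : listSpan a (List.finRange n) = ⊤ := by
  have one_mem : ∀ l : List (Fin n), 1 ∈ listSpan a l := by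
    intro l
    induction l with
    | nil => exact Submodule.one_le.1 le_rfl
    | cons j l ih =>
      rw [listSpan, List.map_cons, List.prod_cons, ← mul_one 1]
      exact Submodule.mul_mem_mul (Subalgebra.one_mem _) ih
  refine (Submodule.eq_top_iff'.2 fun v => ?_)
  rw [← mul_one v]
  have hv : v ∈ Algebra.adjoin k (Set.range (gen a)) := by rw [adjoin_gen]; trivial
  -- The span is known to be stable under left multiplication by generators, so the induction on `v`
  -- treats `v * y` for all `y` in the span.
  generalize h : (1 : QuantumWeyl a) = y
  have hy : y ∈ listSpan a (List.finRange n) := h ▸ one_mem _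
  clear h
  induction hv using Algebra.adjoin_induction generalizing y with
  | mem x hx =>
    obtain ⟨i, rfl⟩ := hx
    exact gen_mul_mem_listSpan a (List.mem_finRange i) hy
  | algebraMap c =>
    rw [← Algebra.smul_def]
    exact Submodule.smul_mem _ _ hy
  | add u w _ _ hu hw =>
    rw [add_mul]
    exact add_mem (hu y hy) (hw y hy)
  | mul u w _ _ hu hw =>
    rw [mul_assoc]
    exact hu _ (hw y hy)

lemma listSpan_le {l : List (Fin n)} (hl : l.Nodup) :
    listSpan a l ≤ Submodule.span k (Set.range (listMonomial a l)) := by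
  induction l with
  | nil =>
    simp only [listSpan, List.map_nil, List.prod_nil, Submodule.one_eq_span]
    refine Submodule.span_mono ?_
    rintro _ rfl
    exact ⟨0, by simp [listMonomial]⟩
  | cons j l ih =>
    rw [List.nodup_cons] at hl
    rw [listSpan, List.map_cons, List.prod_cons, Algebra.adjoin_eq_span]
    refine (mul_le_mul_right (ih hl.2) _).trans ?_
    rw [Submodule.span_mul_span, Submodule.span_le]
    rintro _ ⟨p, hp, _, ⟨e, rfl⟩, rfl⟩
    obtain ⟨m, rfl⟩ := Submonoid.mem_closure_singleton.1 hp
    refine Submodule.subset_span ⟨e.update j m, ?_⟩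
    rw [listMonomial_cons, Finsupp.coe_update, Function.update_self]
    change _ = gen a j ^ m * _
    congr 1
    refine congrArg List.prod (List.map_congr_left fun i hi => ?_)
    rw [Finsupp.coe_update]
    rw [Function.update_of_ne (ne_of_mem_of_not_mem hi hl.1)]

lemma span_orderedMonomial : Submodule.span k (Set.range (orderedMonomial a)) = ⊤ :=
  eq_top_iff.2 ((listSpan_finRange a).ge.trans (listSpan_le a (List.nodup_finRange n)))

lemma linearCombination_normalForm (v : QuantumWeyl a) :
    Finsupp.linearCombination k (orderedMonomial a) (normalForm a v) = v := by
  have hv : v ∈ Submodule.span k (Set.range (orderedMonomial a)) := by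
    rw [span_orderedMonomial]; trivial
  induction hv using Submodule.span_induction with
  | mem x hx => obtain ⟨e, rfl⟩ := hx; simp
  | zero => simp
  | add x y _ _ hx hy => rw [map_add, map_add, hx, hy]
  | smul c x _ hx => rw [map_smul, map_smul, hx]

lemma normalForm_injective : Function.Injective (normalForm a) :=
  Function.LeftInverse.injective (g := Finsupp.linearCombination k (orderedMonomial a))
    (linearCombination_normalForm a)

end Spanning

end ModifiedQuantumWeylAlgebra

namespace ModifiedQuantumWeylAlgebra

/-! ### Leading terms for the divisibility order -/

section LeadingTerm

variable {k : Type*} [Field k] {n : ℕ}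

/-- The span of the monomials that strictly divide the monomial with exponent `e`. -/
noncomputable def lowerTerms (k : Type*) [Field k] {n : ℕ} (e : Fin n →₀ ℕ) :
    Submodule k (NormalSpace k n) :=
  Finsupp.supported k k (Set.Iio e)

lemma single_mem_lowerTerms {e g : Fin n →₀ ℕ} (h : g < e) (c : k) :
    Finsupp.single g c ∈ lowerTerms k e :=
  Finsupp.single_mem_supported k c h

lemma lowerTerms_mono {e f : Fin n →₀ ℕ} (h : e ≤ f) : lowerTerms k e ≤ lowerTerms k f :=
  Finsupp.supported_mono (Set.Iio_subset_Iio h)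

/-- `p` is the sum of the monomial with exponent `e` and coefficient `c`, and of monomials that
strictly divide it. -/
def IsLead (p : NormalSpace k n) (e : Fin n →₀ ℕ) (c : k) : Prop :=
  p - Finsupp.single e c ∈ lowerTerms k e

lemma isLead_single (e : Fin n →₀ ℕ) (c : k) : IsLead (Finsupp.single e c) e c := by
  simp [IsLead]

lemma IsLead.add {p q : NormalSpace k n} {e : Fin n →₀ ℕ} {c d : k} (hp : IsLead p e c)
    (hq : IsLead q e d) : IsLead (p + q) e (c + d) := by
  have := add_mem hp hq
  rwa [sub_add_sub_comm, ← Finsupp.single_add] at this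

lemma IsLead.smul {p : NormalSpace k n} {e : Fin n →₀ ℕ} {c : k} (hp : IsLead p e c) (r : k) :
    IsLead (r • p) e (r * c) := by
  have := Submodule.smul_mem _ r hp
  rwa [smul_sub, Finsupp.smul_single, smul_eq_mul] at this

lemma IsLead.apply_eq {p : NormalSpace k n} {e : Fin n →₀ ℕ} {c : k} (h : IsLead p e c) :
    p e = c := by
  have h1 := (Finsupp.mem_supported' k _).1 h e (by simp)
  rw [Finsupp.sub_apply, Finsupp.single_eq_same, sub_eq_zero] at h1
  exact h1

lemma IsLead.le {p : NormalSpace k n} {e g : Fin n →₀ ℕ} {c : k} (h : IsLead p e c)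
    (hg : p g ≠ 0) : g ≤ e := by
  by_contra hge
  refine hg ?_
  have h1 := (Finsupp.mem_supported' k _).1 h g (fun h => hge (le_of_lt h))
  rwa [Finsupp.sub_apply, Finsupp.single_eq_of_ne (fun h => hge h.le), sub_zero] at h1

/-- Divisibility of monomials is translation invariant, so an operator that shifts leading exponents
of basis vectors by `d` does so for every element with a leading term. -/
lemma IsLead.map {T : NormalSpace k n →ₗ[k] NormalSpace k n} {d : Fin n →₀ ℕ}
    {s : (Fin n →₀ ℕ) → k} (hT : ∀ g, IsLead (T (Finsupp.single g 1)) (g + d) (s g))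
    {p : NormalSpace k n} {e : Fin n →₀ ℕ} {c : k} (h : IsLead p e c) :
    IsLead (T p) (e + d) (s e * c) := by
  have key : lowerTerms k e ≤ (lowerTerms k (e + d)).comap T := by
    rw [lowerTerms, Finsupp.supported_eq_span_single, Submodule.span_le]
    rintro _ ⟨g, hg, rfl⟩
    have hg' : g + d < e + d := add_lt_add_left hg d
    have := add_mem (lowerTerms_mono hg'.le (hT g)) (single_mem_lowerTerms hg' (s g))
    rwa [sub_add_cancel] at this
  have h1 : T p - Finsupp.single (e + d) (s e * c) = T (p - Finsupp.single e c)
      + c • (T (Finsupp.single e 1) - Finsupp.single (e + d) (s e)) := by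
    rw [smul_sub, ← map_smul, Finsupp.smul_single, Finsupp.smul_single, smul_eq_mul, smul_eq_mul,
      mul_one, map_sub, mul_comm]
    abel
  rw [IsLead, h1]
  exact add_mem (key h) (Submodule.smul_mem _ _ (hT e))

variable (a : Fin n → Fin n → k)

lemma IsLead.genOp {p : NormalSpace k n} {e : Fin n →₀ ℕ} {c : k} (h : IsLead p e c) (i : Fin n) :
    IsLead (genOp a i p) (e + Finsupp.single i 1) (belowSign k i e * c) := by
  refine h.map fun g => ?_
  rw [IsLead, genOp_apply, raiseOp_single, one_mul, add_sub_cancel_left]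
  refine sum_mem fun j _ => Submodule.smul_mem _ _ ?_
  rw [lowerOp_single]
  split_ifs
  · refine single_mem_lowerTerms (lt_of_le_of_lt tsub_le_self ?_) _
    exact lt_add_of_pos_right g (by simp [pos_iff_ne_zero])
  · exact zero_mem _

lemma IsLead.genOp_pow {p : NormalSpace k n} {e : Fin n →₀ ℕ} {c : k} (h : IsLead p e c)
    (i : Fin n) (m : ℕ) :
    IsLead ((ModifiedQuantumWeylAlgebra.genOp a i ^ m) p) (e + Finsupp.single i m)
      (belowSign k i e ^ m * c) := by
  induction m with
  | zero => simpa using h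
  | succ m ih =>
    have := ih.genOp a i
    rw [belowSign_add, belowSign_single, if_neg (lt_irrefl i), mul_one, add_assoc,
      ← Finsupp.single_add] at this
    rwa [pow_succ', Module.End.mul_apply, pow_succ', mul_assoc]

lemma IsLead.listMonomial {l : List (Fin n)} (hl : l.Pairwise (· < ·)) (g : Fin n →₀ ℕ)
    {p : NormalSpace k n} {e : Fin n →₀ ℕ} {c : k} (h : IsLead p e c) :
    IsLead (rep a (listMonomial a l g) p) (e + listExponent l g)
      ((l.map fun j => belowSign k j e ^ g j).prod * c) := by
  induction l with
  | nil => simpa [ModifiedQuantumWeylAlgebra.listMonomial, listExponent] using h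
  | cons j l ih =>
    rw [List.pairwise_cons] at hl
    have h1 := (ih hl.2).genOp_pow a j (g j)
    have h2 : belowSign k j (listExponent l g) = 1 := by
      rw [belowSign, Finset.sum_eq_zero, pow_zero]
      intro i hi
      exact listExponent_apply_eq_zero
        (fun h => absurd (hl.1 i h) (not_lt_of_ge (Finset.mem_Iio.1 hi).le)) g
    rw [belowSign_add, h2, mul_one, add_assoc, add_comm (listExponent l g),
      ← listExponent_cons] at h1
    rwa [listMonomial_cons, map_mul, map_pow, rep_gen, Module.End.mul_apply, List.map_cons,
      List.prod_cons, mul_assoc]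

/-- The sign in the product of two ordered monomials. -/
def mulSign (k : Type*) [Field k] {n : ℕ} (g e : Fin n →₀ ℕ) : k := ∏ j, belowSign k j e ^ g j

lemma mulSign_ne_zero (g e : Fin n →₀ ℕ) : mulSign k g e ≠ 0 :=
  Finset.prod_ne_zero_iff.2 fun j _ => pow_ne_zero _ (belowSign_ne_zero j e)

lemma mulSign_single_left (i : Fin n) (e : Fin n →₀ ℕ) :
    mulSign k (Finsupp.single i 1) e = belowSign k i e := by
  rw [mulSign, Finset.prod_eq_single i]
  · simp
  · intro j _ hj
    simp [Finsupp.single_eq_of_ne hj]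
  · simp

lemma isLead_orderedMonomial_mul (g : Fin n →₀ ℕ) {v : QuantumWeyl a} {e : Fin n →₀ ℕ} {c : k}
    (h : IsLead (normalForm a v) e c) :
    IsLead (normalForm a (orderedMonomial a g * v)) (g + e) (mulSign k g e * c) := by
  have := h.listMonomial a (List.pairwise_lt_finRange n) g
  rw [listExponent_finRange, ← List.ofFn_eq_map, List.prod_ofFn] at this
  rwa [normalForm_mul, add_comm g]

/-- Right multiplication by `v`, written in normal forms, is an operator as in `IsLead.map`. -/
lemma IsLead.mul {u v : QuantumWeyl a} {e f : Fin n →₀ ℕ} {c d : k}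
    (hu : IsLead (normalForm a u) e c) (hv : IsLead (normalForm a v) f d) :
    IsLead (normalForm a (u * v)) (e + f) (mulSign k e f * d * c) := by
  have := hu.map (T := normalForm a ∘ₗ LinearMap.mulRight k v ∘ₗ
    Finsupp.linearCombination k (orderedMonomial a)) (s := fun g => mulSign k g f * d) (d := f)
    fun g => by simpa using isLead_orderedMonomial_mul a g hv
  simpa [linearCombination_normalForm] using this

lemma isLead_orderedMonomial (e : Fin n →₀ ℕ) :
    IsLead (normalForm a (orderedMonomial a e)) e 1 := by
  rw [normalForm_orderedMonomial]
  exact isLead_single e 1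

lemma listMonomial_single (l : List (Fin n)) (hl : l.Nodup) (i : Fin n) (hi : i ∈ l) (m : ℕ) :
    listMonomial a l (Finsupp.single i m) = gen a i ^ m := by
  induction l with
  | nil => simp at hi
  | cons j l ih =>
    rw [List.nodup_cons] at hl
    rw [listMonomial_cons]
    rcases eq_or_ne j i with rfl | hij
    · rw [Finsupp.single_eq_same, ModifiedQuantumWeylAlgebra.listMonomial, List.prod_eq_one,
        mul_one]
      intro x hx
      obtain ⟨i, hi, rfl⟩ := List.mem_map.1 hx
      rw [Finsupp.single_eq_of_ne (ne_of_mem_of_not_mem hi hl.1), pow_zero]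
    · rw [Finsupp.single_eq_of_ne hij, pow_zero, one_mul,
        ih hl.2 ((List.mem_cons.1 hi).resolve_left hij.symm)]

lemma orderedMonomial_single (i : Fin n) (m : ℕ) :
    orderedMonomial a (Finsupp.single i m) = gen a i ^ m :=
  listMonomial_single a _ (List.nodup_finRange n) i (List.mem_finRange i) m

lemma orderedMonomial_zero : orderedMonomial a 0 = 1 := by
  rw [orderedMonomial, ModifiedQuantumWeylAlgebra.listMonomial, List.prod_eq_one]
  intro x hx
  obtain ⟨i, -, rfl⟩ := List.mem_map.1 hx
  simp

lemma normalForm_one : normalForm a 1 = Finsupp.single 0 1 := by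
  rw [← orderedMonomial_zero, normalForm_orderedMonomial]

lemma normalForm_gen (i : Fin n) :
    normalForm a (gen a i) = Finsupp.single (Finsupp.single i 1) 1 := by
  rw [← pow_one (gen a i), ← orderedMonomial_single, normalForm_orderedMonomial]

instance : Nontrivial (QuantumWeyl a) :=
  ⟨0, 1, fun h => by simpa [normalForm_one, eq_comm] using congrArg (normalForm a) h⟩

lemma normalForm_mul_eq_sum (u v : QuantumWeyl a) (h : Fin n →₀ ℕ) :
    normalForm a (u * v) h = ∑ g ∈ (normalForm a u).support, ∑ g' ∈ (normalForm a v).support,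
      normalForm a u g * normalForm a v g' *
        normalForm a (orderedMonomial a g * orderedMonomial a g') h := by
  conv_lhs => rw [← linearCombination_normalForm a u, ← linearCombination_normalForm a v]
  rw [Finsupp.linearCombination_apply, Finsupp.linearCombination_apply, Finsupp.sum, Finsupp.sum,
    Finset.sum_mul_sum]
  simp [Finset.sum_apply', mul_assoc, mul_left_comm]

/-- The coefficient of a product in the top degree. -/
lemma normalForm_mul_apply_top {u v : QuantumWeyl a} {m m' : ℕ}
    (hu : ∀ g ∈ (normalForm a u).support, g.degree ≤ m)
    (hv : ∀ g ∈ (normalForm a v).support, g.degree ≤ m') {h : Fin n →₀ ℕ}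
    (hh : h.degree = m + m') :
    normalForm a (u * v) h = ∑ g ∈ (normalForm a u).support, ∑ g' ∈ (normalForm a v).support,
      if g + g' = h then normalForm a u g * normalForm a v g' * mulSign k g g' else 0 := by
  rw [normalForm_mul_eq_sum]
  refine Finset.sum_congr rfl fun g hg => Finset.sum_congr rfl fun g' hg' => ?_
  have h1 : IsLead (normalForm a (orderedMonomial a g * orderedMonomial a g')) (g + g')
      (mulSign k g g') := by
    simpa using isLead_orderedMonomial_mul a g (isLead_orderedMonomial a g')
  split_ifs with h2
  · subst h2
    rw [h1.apply_eq]
  · by_contra h3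
    -- A monomial of the product divides `g + g'`; having at least the same total degree, it equals
    -- it.
    have h4 := h1.le (right_ne_zero_of_mul h3)
    refine h2 ?_
    obtain ⟨d, hd⟩ := exists_add_of_le h4
    have h5 := congrArg Finsupp.degree hd
    simp only [map_add] at h5
    have h6 := hu g hg
    have h7 := hv g' hg'
    have h8 : d.degree = 0 := by omega
    rw [Finsupp.degree_eq_zero_iff] at h8
    rw [hd, h8, add_zero]

end LeadingTerm

end ModifiedQuantumWeylAlgebra

namespace ModifiedQuantumWeylAlgebra

/-! ### Transvections, and infinitely many automorphisms for odd `n` -/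

section Transvection

variable {k : Type*} [CommRing k] {n : ℕ} (a : Fin n → Fin n → k)

/-- Moving `x i` past `x j` twice restores the sign, and the two terms `c i j • x i` cancel. -/
lemma gen_sq_comm (i : Fin n) (v : QuantumWeyl a) : gen a i ^ 2 * v = v * gen a i ^ 2 := by
  have hv : v ∈ Algebra.adjoin k (Set.range (gen a)) := by rw [adjoin_gen]; trivial
  induction hv using Algebra.adjoin_induction with
  | mem x hx =>
    obtain ⟨j, rfl⟩ := hx
    rcases eq_or_ne i j with rfl | hij
    · rw [← pow_succ, ← pow_succ']
    · rw [sq, mul_assoc, gen_mul_gen a hij, mul_sub, ← mul_assoc, gen_mul_gen a hij, sub_mul,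
        Algebra.commutes, sub_sub_cancel, mul_assoc]
  | algebraMap c => rw [Algebra.commutes]
  | add x y _ _ hx hy => rw [mul_add, add_mul, hx, hy]
  | mul x y _ _ hx hy => rw [← mul_assoc, hx, mul_assoc, hy, mul_assoc]

variable {a}

/-- The endomorphism that adds `y` to the generator `x i`, where `y` anticommutes with the other
generators. -/
noncomputable def transvectionHom {i : Fin n} {y : QuantumWeyl a}
    (hy : ∀ j, j ≠ i → gen a j * y + y * gen a j = 0) : QuantumWeyl a →ₐ[k] QuantumWeyl a :=
  lift (fun j => if j = i then gen a i + y else gen a j) fun j l hjl => by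
    split_ifs with h1 h2 h2
    · exact absurd (h1.trans h2.symm) hjl
    · subst h1
      rw [← gen_mul_gen_add a hjl, add_mul, mul_add, add_add_add_comm, add_comm (y * _),
        hy l h2, add_zero]
    · subst h2
      rw [← gen_mul_gen_add a hjl, add_mul, mul_add, add_add_add_comm, hy j h1, add_zero]
    · exact gen_mul_gen_add a hjl

lemma transvectionHom_of_mem {i : Fin n} {y : QuantumWeyl a}
    (hy : ∀ j, j ≠ i → gen a j * y + y * gen a j = 0) {z : QuantumWeyl a}
    (hz : z ∈ Algebra.adjoin k (gen a '' {i}ᶜ)) : transvectionHom hy z = z := by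
  induction hz using Algebra.adjoin_induction with
  | mem x hx =>
    obtain ⟨j, hj, rfl⟩ := hx
    simp only [Set.mem_compl_iff, Set.mem_singleton_iff] at hj
    simp [transvectionHom, hj]
  | algebraMap c => rw [AlgHom.commutes]
  | add x y _ _ hx hy => rw [map_add, hx, hy]
  | mul x y _ _ hx hy => rw [map_mul, hx, hy]

lemma transvectionHom_gen {i : Fin n} {y : QuantumWeyl a}
    (hy : ∀ j, j ≠ i → gen a j * y + y * gen a j = 0) :
    transvectionHom hy (gen a i) = gen a i + y := by
  simp [transvectionHom]

lemma transvectionHom_comp_neg {i : Fin n} {y : QuantumWeyl a}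
    (hy : ∀ j, j ≠ i → gen a j * y + y * gen a j = 0)
    (hy' : ∀ j, j ≠ i → gen a j * -y + -y * gen a j = 0)
    (hz : y ∈ Algebra.adjoin k (gen a '' {i}ᶜ)) :
    (transvectionHom hy).comp (transvectionHom hy') = AlgHom.id k _ := by
  refine algHom_ext fun j => ?_
  rcases eq_or_ne j i with rfl | hj
  · simp [transvectionHom_gen, transvectionHom_of_mem hy hz]
  · have h : gen a j ∈ Algebra.adjoin k (gen a '' {i}ᶜ) :=
      Algebra.subset_adjoin ⟨j, hj, rfl⟩
    simp [transvectionHom_of_mem _ h]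

/-- The automorphism that adds `y` to the generator `x i`, where `y` is a polynomial in the other
generators and anticommutes with them. -/
noncomputable def transvection {i : Fin n} {y : QuantumWeyl a}
    (hy : ∀ j, j ≠ i → gen a j * y + y * gen a j = 0)
    (hz : y ∈ Algebra.adjoin k (gen a '' {i}ᶜ)) : QuantumWeyl a ≃ₐ[k] QuantumWeyl a :=
  have hy' : ∀ j, j ≠ i → gen a j * -y + -y * gen a j = 0 := fun j hj => by
    rw [mul_neg, neg_mul, ← neg_add, hy j hj, neg_zero]
  AlgEquiv.ofAlgHom (transvectionHom hy) (transvectionHom hy')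
    (transvectionHom_comp_neg hy hy' hz)
    (by simpa using transvectionHom_comp_neg hy' (by simpa using hy) (neg_mem hz))

lemma infinite_algEquiv_of_anticomm [Infinite k] {i : Fin n}
    {y : QuantumWeyl a} (hy : ∀ j, j ≠ i → gen a j * y + y * gen a j = 0)
    (hz : y ∈ Algebra.adjoin k (gen a '' {i}ᶜ)) (hinj : Function.Injective fun c : k => c • y) :
    Infinite (QuantumWeyl a ≃ₐ[k] QuantumWeyl a) := by
  have h : ∀ c : k, ∀ j, j ≠ i → gen a j * (c • y) + (c • y) * gen a j = 0 := fun c j hj => by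
    rw [mul_smul_comm, smul_mul_assoc, ← smul_add, hy j hj, smul_zero]
  refine Infinite.of_injective
    (fun c : k => transvection (h c) (Subalgebra.smul_mem _ hz c)) fun c d hcd => hinj ?_
  have := DFunLike.congr_fun hcd (gen a i)
  simpa [transvection, transvectionHom_gen] using this

end Transvection

section Odd

variable {k : Type*} [Field k] [CharZero k] {n : ℕ} (a : Fin n → Fin n → k)

-- The combination is chosen so that the scalar contributions `c • y` from the relation between `z`
-- and `x` cancel.
omit [CharZero k] in
lemma mul_twisted_anticommutator {A : Type*} [Ring A] [Algebra k A] {ε c : k} (hε : ε * ε = 1)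
    {x y z : A} (h1 : z * y = -ε • (y * z)) (h2 : z * x = algebraMap k A c - x * z) :
    z * (y * x + ε • (x * y)) = ε • ((y * x + ε • (x * y)) * z) := by
  rw [mul_add, mul_smul_comm, ← mul_assoc, ← mul_assoc, h1, h2, sub_mul, mul_assoc x z y, h1,
    smul_mul_assoc, mul_assoc y z x, h2, mul_sub, ← Algebra.commutes c y, add_mul, smul_add,
    smul_mul_assoc, smul_smul, hε, mul_smul_comm, smul_sub, smul_sub, smul_smul, mul_neg, hε,
    mul_assoc, mul_assoc]
  module

omit [CharZero k] in
lemma mul_twisted_anticommutator_self {A : Type*} [Ring A] [Algebra k A] {ε : k} (hε : ε * ε = 1)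
    {x y : A} (h : x ^ 2 * y = y * x ^ 2) :
    x * (y * x + ε • (x * y)) = ε • ((y * x + ε • (x * y)) * x) := by
  rw [mul_add, mul_smul_comm, ← mul_assoc x x y, ← sq, h, add_mul, smul_add, smul_mul_assoc,
    smul_smul, hε, one_smul, mul_assoc y, ← sq, mul_assoc, add_comm]

/-- The iterated twisted commutators of the generators: an element that commutes, or anticommutes,
with the first `m` generators. -/
lemma exists_volume_element (m : ℕ) (hm : m ≤ n) :
    ∃ y ∈ Algebra.adjoin k (gen a '' {i | i.val < m}),
      (∃ c ≠ 0, ∃ e : Fin n →₀ ℕ, e.degree = m ∧ (∀ i : Fin n, m ≤ i.val → e i = 0) ∧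
        IsLead (normalForm a y) e c) ∧
      ∀ i : Fin n, i.val < m → gen a i * y = (-1 : k) ^ (m + 1) • (y * gen a i) := by
  induction m with
  | zero =>
    refine ⟨1, one_mem _, ⟨1, one_ne_zero, 0, by simp, by simp, ?_⟩, by simp⟩
    rw [normalForm_one]
    exact isLead_single 0 1
  | succ m ih =>
    obtain ⟨y, hy, ⟨c, hc, e, he, he', hlead⟩, hcomm⟩ := ih (by omega)
    let i₀ : Fin n := ⟨m, by omega⟩
    set x := gen a i₀ with hx
    have hxlead : IsLead (normalForm a x) (Finsupp.single i₀ 1) 1 := by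
      rw [hx, normalForm_gen]; exact isLead_single _ _
    have hx2 := gen_sq_comm a i₀
    rw [← hx] at hx2
    -- Both summands have the same leading term, since `x * y` and `y * x` differ to leading order
    -- by `(-1) ^ m`. The leading coefficient doubles and survives in characteristic zero.
    refine ⟨y * x + (-1 : k) ^ m • (x * y), ?_, ⟨2 * c, by simpa using hc,
      e + Finsupp.single i₀ 1, by simp [he], ?_, ?_⟩, ?_⟩
    · have h0 : {i : Fin n | i.val < m} ⊆ {i | i.val < m + 1} := fun i hi => Nat.lt_succ_of_lt hi
      have h1 : y ∈ Algebra.adjoin k (gen a '' {i | i.val < m + 1}) :=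
        Algebra.adjoin_mono (Set.image_mono h0) hy
      have h2 : x ∈ Algebra.adjoin k (gen a '' {i | i.val < m + 1}) :=
        Algebra.subset_adjoin ⟨i₀, Nat.lt_succ_self m, rfl⟩
      exact add_mem (mul_mem h1 h2) (Subalgebra.smul_mem _ (mul_mem h2 h1) _)
    · intro i hi
      have : i ≠ i₀ := fun h => by simp [h, i₀] at hi
      simp [he' i (by omega), Finsupp.single_eq_of_ne this]
    · have h1 := hlead.mul a hxlead
      have h2 := (hxlead.mul a hlead).smul ((-1 : k) ^ m)
      have hs : belowSign k i₀ e = (-1) ^ m := by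
        rw [belowSign, ← he, Finsupp.degree_eq_sum]
        congr 1
        refine Finset.sum_subset (Finset.subset_univ _) fun i _ hi => he' i ?_
        simpa [i₀, Fin.lt_def] using hi
      have hs' : mulSign k e (Finsupp.single i₀ 1) = 1 := by
        refine Finset.prod_eq_one fun j _ => ?_
        rw [belowSign_single]
        split_ifs with h
        · rw [he' j (le_of_lt h), pow_zero]
        · exact one_pow _
      rw [mulSign_single_left, hs, mul_one, ← mul_assoc, ← mul_pow, add_comm] at h2
      rw [hs', one_mul, one_mul] at h1
      have h3 := h1.add h2
      rw [← map_smul, ← map_add] at h3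
      convert h3 using 1
      simp; ring
    · intro i hi
      have hε : (-1 : k) ^ m * (-1) ^ m = 1 := by rw [← mul_pow]; simp
      rw [pow_succ, pow_succ, mul_assoc, neg_one_mul, neg_neg, mul_one]
      rcases eq_or_ne i i₀ with rfl | hne
      · exact mul_twisted_anticommutator_self hε (hx2 y)
      · have hlt : i.val < m := by
          have : i.val ≠ m := fun h => hne (Fin.ext h)
          omega
        refine mul_twisted_anticommutator hε ?_ (gen_mul_gen a hne)
        rw [hcomm i hlt, pow_succ, mul_neg_one]

/-- The volume element of the first `2 * m` generators anticommutes with each of them because `2 *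
m` is even, so multiples of it can be added to the last generator. -/
theorem infinite_algEquiv_of_odd (hn : Odd n) :
    Infinite (QuantumWeyl a ≃ₐ[k] QuantumWeyl a) := by
  obtain ⟨m, rfl⟩ := hn
  obtain ⟨y, hy, ⟨c, hc, e, -, -, hlead⟩, hcomm⟩ := exists_volume_element a (2 * m) (by omega)
  have hlt : ∀ j : Fin (2 * m + 1), j ≠ Fin.last _ → j.val < 2 * m := fun j hj => by
    have : j.val ≠ 2 * m := fun h => hj (Fin.ext h)
    omega
  refine infinite_algEquiv_of_anticomm (i := Fin.last _) (y := y) (fun j hj => ?_)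
    (Algebra.adjoin_mono (Set.image_mono ?_) hy) fun r s hrs => ?_
  · rw [hcomm j (hlt j hj)]
    simp [pow_succ, pow_mul]
  · rintro j hj rfl
    exact absurd hj (lt_irrefl (2 * m))
  · have := congrArg (fun v => normalForm a v e) hrs
    simpa [hlead.apply_eq, hc] using this

end Odd

end ModifiedQuantumWeylAlgebra

namespace ModifiedQuantumWeylAlgebra

/-! ### The algebra as a free module over the polynomials in the squares -/

section CentralPolynomials

open MvPolynomial

variable {k : Type*} [CommRing k] {n : ℕ} (a : Fin n → Fin n → k)

/-- The homomorphism that maps the variables of a polynomial ring to the squares of the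
generators. -/
noncomputable def centralHom : MvPolynomial (Fin n) k →ₐ[k] Subalgebra.center k (QuantumWeyl a) :=
  aeval fun i => ⟨gen a i ^ 2, Subalgebra.mem_center_iff.2 fun v => (gen_sq_comm a i v).symm⟩

noncomputable instance : Algebra (MvPolynomial (Fin n) k) (QuantumWeyl a) :=
  RingHom.toAlgebra' ((Subalgebra.center k (QuantumWeyl a)).val.comp (centralHom a)).toRingHom
    fun r v => (Subalgebra.mem_center_iff.1 (centralHom a r).2 v).symm

lemma algebraMap_eq_centralHom (r : MvPolynomial (Fin n) k) :
    algebraMap (MvPolynomial (Fin n) k) (QuantumWeyl a) r = centralHom a r := rfl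

@[simp] lemma algebraMap_X (i : Fin n) :
    algebraMap (MvPolynomial (Fin n) k) (QuantumWeyl a) (X i) = gen a i ^ 2 := by
  simp [algebraMap_eq_centralHom, centralHom]

instance : IsScalarTower k (MvPolynomial (Fin n) k) (QuantumWeyl a) :=
  IsScalarTower.of_algebraMap_eq fun c => by
    rw [algebraMap_eq_centralHom, AlgHom.commutes]; rfl

end CentralPolynomials

section CentralBasis

open MvPolynomial

variable {k : Type*} [Field k] {n : ℕ} (a : Fin n → Fin n → k)

lemma algebraMap_mul_listMonomial (l : List (Fin n)) (f e : Fin n →₀ ℕ) :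
    algebraMap (MvPolynomial (Fin n) k) (QuantumWeyl a) (l.map fun j => X j ^ f j).prod
      * listMonomial a l e = listMonomial a l (2 • f + e) := by
  induction l with
  | nil => simp [listMonomial]
  | cons j l ih =>
    rw [listMonomial_cons, listMonomial_cons, ← ih, List.map_cons, List.prod_cons, map_mul,
      map_pow, algebraMap_X, mul_assoc, ← mul_assoc (algebraMap _ _ _) (gen a j ^ e j),
      Algebra.commutes, ← pow_mul, mul_assoc, ← mul_assoc, ← pow_add]
    simp

lemma monomial_smul_orderedMonomial (f e : Fin n →₀ ℕ) (c : k) :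
    monomial f c • orderedMonomial a e = c • orderedMonomial a (2 • f + e) := by
  have h : (monomial f c : MvPolynomial (Fin n) k) =
      c • ((List.finRange n).map fun j => X j ^ f j).prod := by
    rw [← List.ofFn_eq_map, List.prod_ofFn, monomial_eq, Finsupp.prod_fintype _ _ (by simp),
      smul_eq_C_mul]
  rw [h, smul_assoc, Algebra.smul_def (List.prod _), orderedMonomial, algebraMap_mul_listMonomial]
  rfl

/-- The exponent of a squarefree monomial. -/
noncomputable def squarefreeExponent (S : Finset (Fin n)) : Fin n →₀ ℕ :=
  Finsupp.indicator S fun _ _ => 1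

@[simp] lemma squarefreeExponent_apply (S : Finset (Fin n)) (i : Fin n) :
    squarefreeExponent S i = if i ∈ S then 1 else 0 := by
  simp [squarefreeExponent, Finsupp.indicator_apply]

lemma two_smul_add_squarefreeExponent_inj {f g : Fin n →₀ ℕ} {S T : Finset (Fin n)} :
    2 • f + squarefreeExponent S = 2 • g + squarefreeExponent T ↔ f = g ∧ S = T := by
  refine ⟨fun h => ?_, by rintro ⟨rfl, rfl⟩; rfl⟩
  have h1 : ∀ i, f i = g i ∧ (i ∈ S ↔ i ∈ T) := fun i => by
    have := DFunLike.congr_fun h i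
    simp only [Finsupp.add_apply, Finsupp.smul_apply, smul_eq_mul, squarefreeExponent_apply] at this
    split_ifs at this with h1 h2 h2 <;> simp [h1, h2] <;> omega
  exact ⟨Finsupp.ext fun i => (h1 i).1, Finset.ext fun i => (h1 i).2⟩

lemma exists_eq_two_smul_add_squarefreeExponent (e : Fin n →₀ ℕ) :
    ∃ f S, e = 2 • f + squarefreeExponent S := by
  refine ⟨e.mapRange (· / 2) rfl, Finset.univ.filter fun i => Odd (e i), Finsupp.ext fun i => ?_⟩
  simp only [Finsupp.add_apply, Finsupp.smul_apply, Finsupp.mapRange_apply, smul_eq_mul,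
    squarefreeExponent_apply, Finset.mem_filter, Finset.mem_univ, true_and]
  split_ifs with h
  · have := Nat.odd_iff.1 h; omega
  · rw [Nat.not_odd_iff_even] at h
    have := Nat.even_iff.1 h; omega

lemma normalForm_smul_apply (r : MvPolynomial (Fin n) k) (S T : Finset (Fin n))
    (f : Fin n →₀ ℕ) :
    normalForm a (r • orderedMonomial a (squarefreeExponent T)) (2 • f + squarefreeExponent S)
      = if S = T then coeff f r else 0 := by
  induction r using MvPolynomial.induction_on' with
  | monomial g c =>
    rw [monomial_smul_orderedMonomial, map_smul, normalForm_orderedMonomial]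
    simp only [Finsupp.smul_apply, Finsupp.single_apply, two_smul_add_squarefreeExponent_inj,
      coeff_monomial, smul_eq_mul, mul_ite, mul_one, mul_zero, eq_comm (a := T), ite_and]
    split_ifs <;> rfl
  | add p q hp hq =>
    rw [add_smul, LinearMap.map_add, Finsupp.add_apply, hp, hq, coeff_add]
    split_ifs <;> simp

lemma normalForm_sum_smul_apply (r : Finset (Fin n) → MvPolynomial (Fin n) k)
    (S : Finset (Fin n)) (f : Fin n →₀ ℕ) :
    normalForm a (∑ T, r T • orderedMonomial a (squarefreeExponent T))
      (2 • f + squarefreeExponent S) = coeff f (r S) := by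
  rw [map_sum, Finsupp.finsetSum_apply]
  simp [normalForm_smul_apply]

/-- The squarefree ordered monomials, as a basis over the polynomials in the squares of the
generators. -/
noncomputable def squarefreeBasis :
    Module.Basis (Finset (Fin n)) (MvPolynomial (Fin n) k) (QuantumWeyl a) :=
  Module.Basis.mk (v := fun S => orderedMonomial a (squarefreeExponent S))
    (by
      rw [Fintype.linearIndependent_iff]
      intro r hr S
      ext f
      rw [← normalForm_sum_smul_apply a r S f, hr]
      simp)
    (by
      intro v _
      rw [← linearCombination_normalForm a v, Finsupp.linearCombination_apply]
      refine sum_mem fun e _ => Submodule.smul_of_tower_mem _ _ ?_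
      obtain ⟨f, S, rfl⟩ := exists_eq_two_smul_add_squarefreeExponent e
      have := monomial_smul_orderedMonomial a f (squarefreeExponent S) 1
      rw [one_smul] at this
      rw [← this]
      exact Submodule.smul_mem _ _ (Submodule.subset_span ⟨S, rfl⟩))

@[simp] lemma squarefreeBasis_apply (S : Finset (Fin n)) :
    squarefreeBasis a S = orderedMonomial a (squarefreeExponent S) := by
  simp [squarefreeBasis]

/-- Every exponent is uniquely `2 • f + squarefreeExponent S`, so the coordinates over the
polynomial ring are a regrouping of the normal form. -/
lemma coeff_squarefreeBasis_repr (v : QuantumWeyl a) (S : Finset (Fin n)) (f : Fin n →₀ ℕ) :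
    coeff f ((squarefreeBasis a).repr v S) = normalForm a v (2 • f + squarefreeExponent S) := by
  conv_rhs => rw [← (squarefreeBasis a).sum_repr v]
  simp only [squarefreeBasis_apply]
  rw [normalForm_sum_smul_apply]

lemma algebraMap_injective :
    Function.Injective (algebraMap (MvPolynomial (Fin n) k) (QuantumWeyl a)) := by
  have : Module.Free (MvPolynomial (Fin n) k) (QuantumWeyl a) :=
    Module.Free.of_basis (squarefreeBasis a)
  exact FaithfulSMul.algebraMap_injective _ _

end CentralBasis

end ModifiedQuantumWeylAlgebra

/-! ### The trace discriminant and semilinear automorphisms -/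

section TraceDiscriminant

variable {ι R V : Type*} [Fintype ι] [DecidableEq ι] [CommRing R] [Ring V] [Algebra R V]

/-- The trace form of an algebra that need not be commutative. -/
noncomputable def leftTraceForm (R V : Type*) [CommRing R] [Ring V] [Algebra R V] :
    LinearMap.BilinForm R V :=
  (LinearMap.mul R V).compr₂ (LinearMap.trace R V ∘ₗ LinearMap.mul R V)

lemma leftTraceForm_apply (u v : V) :
    leftTraceForm R V u v = LinearMap.trace R V (LinearMap.mulLeft R (u * v)) := rfl

lemma trace_mulLeft_eq_sum (b : Module.Basis ι R V) (u : V) :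
    LinearMap.trace R V (LinearMap.mulLeft R u) = ∑ i, b.repr (u * b i) i := by
  rw [LinearMap.trace_eq_matrix_trace R b, Matrix.trace]
  simp [Algebra.leftMulMatrix_eq_repr_mul]

/-- The discriminant of the trace form with respect to a basis. -/
noncomputable def traceDiscr (b : Module.Basis ι R V) : R :=
  (Matrix.of fun i j => leftTraceForm R V (b i) (b j)).det

/-- The image of a basis under a semilinear ring automorphism. -/
noncomputable def Module.Basis.semilinearMap (b : Module.Basis ι R V) (τ : V ≃+* V) (ψ : R ≃+* R)
    (h : ∀ r, τ (algebraMap R V r) = algebraMap R V (ψ r)) : Module.Basis ι R V :=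
  Module.Basis.ofEquivFun
    { toFun := fun v i => ψ (b.repr (τ.symm v) i)
      invFun := fun r => τ (∑ i, ψ.symm (r i) • b i)
      map_add' := fun u v => by ext i; simp
      map_smul' := fun r v => by
        ext i
        have : τ.symm (r • v) = ψ.symm r • τ.symm v := by
          apply τ.injective
          simp [Algebra.smul_def, h]
        simp [this]
      left_inv := fun v => by simp [b.sum_repr]
      right_inv := fun r => by
        ext i
        dsimp only
        rw [RingEquiv.symm_apply_apply, b.repr_sum_self, RingEquiv.apply_symm_apply] }

lemma Module.Basis.semilinearMap_apply (b : Module.Basis ι R V) (τ : V ≃+* V) (ψ : R ≃+* R)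
    (h : ∀ r, τ (algebraMap R V r) = algebraMap R V (ψ r)) (i : ι) :
    b.semilinearMap τ ψ h i = τ (b i) := by
  rw [semilinearMap, Module.Basis.coe_ofEquivFun]
  change τ (∑ j, ψ.symm (Pi.single (M := fun _ => R) i 1 j) • b j) = _
  congr 1
  rw [Finset.sum_eq_single i]
  · simp
  · intro j _ hj
    simp [hj]
  · simp

omit [DecidableEq ι] in
lemma Module.Basis.semilinearMap_repr (b : Module.Basis ι R V) (τ : V ≃+* V) (ψ : R ≃+* R)
    (h : ∀ r, τ (algebraMap R V r) = algebraMap R V (ψ r)) (v : V) (i : ι) :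
    (b.semilinearMap τ ψ h).repr (τ v) i = ψ (b.repr v i) := by
  rw [← Module.Basis.equivFun_apply, semilinearMap, Module.Basis.equivFun_ofEquivFun]
  change ψ (b.repr (τ.symm (τ v)) i) = _
  rw [RingEquiv.symm_apply_apply]

/-- The trace does not depend on the basis: that of `τ u * τ v` is computed in the image basis,
whose coordinates are the `ψ`-images of the old ones. -/
lemma leftTraceForm_semilinear (b : Module.Basis ι R V) (τ : V ≃+* V) (ψ : R ≃+* R)
    (h : ∀ r, τ (algebraMap R V r) = algebraMap R V (ψ r)) (u v : V) :
    leftTraceForm R V (τ u) (τ v) = ψ (leftTraceForm R V u v) := by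
  rw [leftTraceForm_apply, leftTraceForm_apply, trace_mulLeft_eq_sum b (u * v),
    trace_mulLeft_eq_sum (b.semilinearMap τ ψ h), map_sum]
  refine Finset.sum_congr rfl fun i _ => ?_
  rw [Module.Basis.semilinearMap_apply, ← map_mul, ← map_mul, Module.Basis.semilinearMap_repr]

lemma traceDiscr_semilinearMap (b : Module.Basis ι R V) (τ : V ≃+* V) (ψ : R ≃+* R)
    (h : ∀ r, τ (algebraMap R V r) = algebraMap R V (ψ r)) :
    traceDiscr (b.semilinearMap τ ψ h) = ψ (traceDiscr b) := by
  rw [traceDiscr, traceDiscr, RingEquiv.map_det]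
  congr 1
  ext i j
  simp [Module.Basis.semilinearMap_apply, leftTraceForm_semilinear b τ ψ h]

/-- The unit is the square of the determinant of the change of basis. -/
lemma traceDiscr_eq_mul (b c : Module.Basis ι R V) :
    ∃ u : R, IsUnit u ∧ traceDiscr c = u * traceDiscr b := by
  have h : ∀ d : Module.Basis ι R V,
      traceDiscr d = (LinearMap.BilinForm.toMatrix d (leftTraceForm R V)).det := fun d => by
    rw [traceDiscr]
    congr 1
    ext i j
    simp
  have h1 := LinearMap.BilinForm.toMatrix_mul_basis_toMatrix (b := b) c (leftTraceForm R V)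
  refine ⟨(b.toMatrix c).det * (b.toMatrix c).det, ?_, ?_⟩
  · have : IsUnit (b.toMatrix c).det := by
      have h2 := congrArg Matrix.det (b.toMatrix_mul_toMatrix_flip c)
      rw [Matrix.det_mul, Matrix.det_one] at h2
      exact IsUnit.of_mul_eq_one _ h2
    exact this.mul this
  · rw [h, h, ← h1, Matrix.det_mul, Matrix.det_mul, Matrix.det_transpose]
    ring

/-- A semilinear automorphism multiplies the discriminant by a unit. -/
lemma exists_isUnit_map_traceDiscr (b : Module.Basis ι R V) (τ : V ≃+* V) (ψ : R ≃+* R)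
    (h : ∀ r, τ (algebraMap R V r) = algebraMap R V (ψ r)) :
    ∃ u : R, IsUnit u ∧ ψ (traceDiscr b) = u * traceDiscr b := by
  rw [← traceDiscr_semilinearMap b τ ψ h]
  exact traceDiscr_eq_mul b _

end TraceDiscriminant

/-! ### Polynomials with exponents in a box -/

section Box

open MvPolynomial

variable {σ k : Type*} [CommRing k]

lemma coeff_zsmul_eq (f : σ →₀ ℕ) (z : ℤ) (p : MvPolynomial σ k) :
    coeff f (z • p) = z • coeff f p :=
  map_zsmul (coeffAddMonoidHom f) z p

/-- The corner `g + h` of the product box is reached only by the two corners `g` and `h`. -/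
lemma coeff_mul_top_of_le {p q : MvPolynomial σ k} {g h : σ →₀ ℕ}
    (hp : ∀ f, coeff f p ≠ 0 → f ≤ g) (hq : ∀ f, coeff f q ≠ 0 → f ≤ h) :
    (∀ f, coeff f (p * q) ≠ 0 → f ≤ g + h) ∧ coeff (g + h) (p * q) = coeff g p * coeff h q := by
  classical
  refine ⟨fun f hf => ?_, ?_⟩
  · rw [coeff_mul] at hf
    obtain ⟨⟨x, y⟩, hxy, h1⟩ := Finset.exists_ne_zero_of_sum_ne_zero hf
    rw [← Finset.HasAntidiagonal.mem_antidiagonal.1 hxy]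
    exact add_le_add (hp x (left_ne_zero_of_mul h1)) (hq y (right_ne_zero_of_mul h1))
  · rw [coeff_mul, Finset.sum_eq_single (g, h)]
    · rintro ⟨x, y⟩ hxy hne
      by_contra h1
      have hx := hp x (left_ne_zero_of_mul h1)
      have hy := hq y (right_ne_zero_of_mul h1)
      have hs := Finset.HasAntidiagonal.mem_antidiagonal.1 hxy
      have := (add_eq_add_iff_eq_and_eq hx hy).1 hs
      exact hne (Prod.ext this.1 this.2)
    · simp

lemma coeff_prod_top_of_le {ι : Type*} (s : Finset ι) (p : ι → MvPolynomial σ k)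
    (g : ι → σ →₀ ℕ) (h : ∀ i ∈ s, ∀ f, coeff f (p i) ≠ 0 → f ≤ g i) :
    (∀ f, coeff f (∏ i ∈ s, p i) ≠ 0 → f ≤ ∑ i ∈ s, g i) ∧
      coeff (∑ i ∈ s, g i) (∏ i ∈ s, p i) = ∏ i ∈ s, coeff (g i) (p i) := by
  classical
  induction s using Finset.induction_on with
  | empty =>
    refine ⟨fun f hf => ?_, by simp⟩
    rw [Finset.prod_empty, coeff_one] at hf
    rw [← (ite_ne_right_iff.1 hf).1, Finset.sum_empty]
  | insert i s hi ih =>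
    rw [Finset.prod_insert hi, Finset.sum_insert hi, Finset.prod_insert hi]
    obtain ⟨h1, h2⟩ := ih fun j hj => h j (Finset.mem_insert_of_mem hj)
    rw [← h2]
    exact coeff_mul_top_of_le (h i (Finset.mem_insert_self i s)) h1

end Box

/-- A permutation preserves the sum of all cardinalities, so no inclusion can be strict. -/
lemma Equiv.Perm.eq_one_of_subset {α : Type*} [Fintype α]
    (σ : Equiv.Perm (Finset α)) (h : ∀ S, S ⊆ σ S) : σ = 1 := by
  classical
  have h1 : ∑ S : Finset α, S.card = ∑ S, (σ S).card := (Equiv.sum_comp σ Finset.card).symm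
  have h2 := (Finset.sum_eq_sum_iff_of_le fun S _ => Finset.card_le_card (h S)).1 h1
  ext1 S
  exact (Finset.eq_of_subset_of_card_le (h S) (h2 S (Finset.mem_univ S)).ge).symm

namespace ModifiedQuantumWeylAlgebra

/-! ### The dominating monomial of the discriminant -/

section Discriminant

open MvPolynomial

variable {k : Type*} [Field k] {n : ℕ} (a : Fin n → Fin n → k)

lemma coeff_leftTraceForm (S T : Finset (Fin n)) (f : Fin n →₀ ℕ) :
    coeff f (leftTraceForm (MvPolynomial (Fin n) k) (QuantumWeyl a) (squarefreeBasis a S)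
      (squarefreeBasis a T)) = ∑ U, normalForm a
        (orderedMonomial a (squarefreeExponent S) * orderedMonomial a (squarefreeExponent T)
          * orderedMonomial a (squarefreeExponent U)) (2 • f + squarefreeExponent U) := by
  rw [leftTraceForm_apply, trace_mulLeft_eq_sum (squarefreeBasis a), coeff_sum]
  simp only [coeff_squarefreeBasis_repr, squarefreeBasis_apply]

lemma isLead_mul_mul (S T U : Finset (Fin n)) :
    IsLead (normalForm a (orderedMonomial a (squarefreeExponent S)
      * orderedMonomial a (squarefreeExponent T) * orderedMonomial a (squarefreeExponent U)))
      (squarefreeExponent S + squarefreeExponent T + squarefreeExponent U)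
      (mulSign k (squarefreeExponent S + squarefreeExponent T) (squarefreeExponent U)
        * mulSign k (squarefreeExponent S) (squarefreeExponent T)) := by
  have := ((isLead_orderedMonomial a (squarefreeExponent S)).mul a
    (isLead_orderedMonomial a (squarefreeExponent T))).mul a
    (isLead_orderedMonomial a (squarefreeExponent U))
  simpa using this

/-- A diagonal coefficient at `U` has exponent `2 • f` bounded by that of the product of the
monomials of `S` and `T`; halving leaves the common variables. -/
lemma le_of_coeff_leftTraceForm_ne_zero {S T : Finset (Fin n)} {f : Fin n →₀ ℕ}
    (h : coeff f (leftTraceForm (MvPolynomial (Fin n) k) (QuantumWeyl a) (squarefreeBasis a S)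
      (squarefreeBasis a T)) ≠ 0) : f ≤ squarefreeExponent (S ∩ T) := by
  rw [coeff_leftTraceForm] at h
  obtain ⟨U, -, hU⟩ := Finset.exists_ne_zero_of_sum_ne_zero h
  have h1 := (isLead_mul_mul a S T U).le hU
  rw [add_le_add_iff_right] at h1
  intro i
  have h2 := h1 i
  simp only [Finsupp.smul_apply, Finsupp.add_apply, squarefreeExponent_apply, smul_eq_mul,
    Finset.mem_inter] at h2 ⊢
  split_ifs at h2 ⊢ <;> simp_all <;> omega

lemma mulSign_add_self (g e : Fin n →₀ ℕ) : mulSign k (g + g) e = 1 :=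
  Finset.prod_eq_one fun j _ => by
    rw [Finsupp.add_apply, ← two_mul, pow_mul, sq, belowSign_mul_self, one_pow]

/-- All `U` contribute the same sign, so the sum is that sign times the number of subsets. -/
lemma coeff_leftTraceForm_self_ne_zero [CharZero k] (S : Finset (Fin n)) :
    coeff (squarefreeExponent S) (leftTraceForm (MvPolynomial (Fin n) k) (QuantumWeyl a)
      (squarefreeBasis a S) (squarefreeBasis a S)) ≠ 0 := by
  rw [coeff_leftTraceForm]
  have h : ∀ U : Finset (Fin n), normalForm a
      (orderedMonomial a (squarefreeExponent S) * orderedMonomial a (squarefreeExponent S)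
        * orderedMonomial a (squarefreeExponent U))
      (2 • squarefreeExponent S + squarefreeExponent U) =
      mulSign k (squarefreeExponent S) (squarefreeExponent S) := fun U => by
    rw [two_nsmul, (isLead_mul_mul a S S U).apply_eq, mulSign_add_self, one_mul]
  simp only [h, Finset.sum_const, nsmul_eq_mul]
  exact mul_ne_zero (Nat.cast_ne_zero.2 (Finset.card_pos.2 ⟨∅, Finset.mem_univ _⟩).ne')
    (mulSign_ne_zero _ _)

/-- The exponent of the dominating monomial of the discriminant. -/
noncomputable def discrExponent (n : ℕ) : Fin n →₀ ℕ :=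
  ∑ S : Finset (Fin n), squarefreeExponent S

lemma discrExponent_pos (i : Fin n) : 0 < discrExponent n i := by
  rw [discrExponent, Finsupp.finsetSum_apply]
  exact Finset.sum_pos' (fun _ _ => Nat.zero_le _) ⟨{i}, Finset.mem_univ _, by simp⟩

lemma squarefreeExponent_mono {S T : Finset (Fin n)} (h : S ⊆ T) :
    squarefreeExponent S ≤ squarefreeExponent T := fun i => by
  simp only [squarefreeExponent_apply]
  split_ifs with h1 h2 <;> simp_all
  exact h2 (h h1)

lemma sum_squarefreeExponent_inter_le (σ : Equiv.Perm (Finset (Fin n))) :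
    ∑ S, squarefreeExponent (σ S ∩ S) ≤ discrExponent n :=
  Finset.sum_le_sum fun _ _ => squarefreeExponent_mono Finset.inter_subset_right

/-- In the Leibniz expansion of the discriminant, only the identity permutation therefore reaches
the exponent `discrExponent n`. -/
lemma sum_squarefreeExponent_inter_ne {σ : Equiv.Perm (Finset (Fin n))} (hσ : σ ≠ 1) :
    ∑ S, squarefreeExponent (σ S ∩ S) ≠ discrExponent n := by
  intro h
  refine hσ (Equiv.Perm.eq_one_of_subset σ fun S i hi => ?_)
  have h1 := (Finset.sum_eq_sum_iff_of_le fun S _ =>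
    squarefreeExponent_mono (S := σ S ∩ S) (T := S) Finset.inter_subset_right).1 h S
    (Finset.mem_univ S)
  have h2 := DFunLike.congr_fun h1 i
  by_contra h3
  simp [hi, h3] at h2

lemma le_of_coeff_traceDiscr_ne_zero {f : Fin n →₀ ℕ}
    (h : coeff f (traceDiscr (squarefreeBasis a)) ≠ 0) : f ≤ discrExponent n := by
  rw [traceDiscr, Matrix.det_apply, coeff_sum] at h
  obtain ⟨σ, -, hσ⟩ := Finset.exists_ne_zero_of_sum_ne_zero h
  rw [Units.smul_def, coeff_zsmul_eq] at hσ
  refine ((coeff_prod_top_of_le _ _ (fun S => squarefreeExponent (σ S ∩ S))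
    fun S _ f hf => ?_).1 f (right_ne_zero_of_smul hσ)).trans (sum_squarefreeExponent_inter_le σ)
  exact le_of_coeff_leftTraceForm_ne_zero a hf

lemma coeff_traceDiscr_ne_zero [CharZero k] :
    coeff (discrExponent n) (traceDiscr (squarefreeBasis a)) ≠ 0 := by
  rw [traceDiscr, Matrix.det_apply, coeff_sum, Finset.sum_eq_single 1]
  · have := (coeff_prod_top_of_le Finset.univ (fun S : Finset (Fin n) =>
      leftTraceForm (MvPolynomial (Fin n) k) (QuantumWeyl a) (squarefreeBasis a S)
      (squarefreeBasis a S)) squarefreeExponent fun S _ f hf => by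
        simpa using le_of_coeff_leftTraceForm_ne_zero a hf).2
    rw [← discrExponent] at this
    simp only [Equiv.Perm.sign_one, one_smul, Equiv.Perm.one_apply, Matrix.of_apply]
    rw [this]
    exact Finset.prod_ne_zero_iff.2 fun S _ => coeff_leftTraceForm_self_ne_zero a S
  · intro σ _ hσ
    rw [Units.smul_def, coeff_zsmul_eq]
    by_contra h
    refine sum_squarefreeExponent_inter_ne hσ (le_antisymm (sum_squarefreeExponent_inter_le σ) ?_)
    exact (coeff_prod_top_of_le _ _ (fun S => squarefreeExponent (σ S ∩ S))
      fun S _ f hf => le_of_coeff_leftTraceForm_ne_zero a hf).1 _ (right_ne_zero_of_smul h)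
  · simp

end Discriminant

end ModifiedQuantumWeylAlgebra

/-! ### Substitution in a polynomial with a dominating monomial -/

section DominatingMonomial

open MvPolynomial

variable {σ k : Type*} [Fintype σ] [Field k]

omit [Fintype σ] in
lemma totalDegree_prod_pow (s : Finset σ) (e : σ → ℕ) {g : σ → MvPolynomial σ k}
    (hg : ∀ i, g i ≠ 0) :
    (∏ i ∈ s, g i ^ e i).totalDegree = ∑ i ∈ s, e i * (g i).totalDegree := by
  classical
  have hpow : ∀ i m, (g i ^ m).totalDegree = m * (g i).totalDegree := fun i m => by
    induction m with
    | zero => simp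
    | succ m ih =>
      rw [pow_succ, totalDegree_mul_of_isDomain (pow_ne_zero _ (hg i)) (hg i), ih, add_one_mul]
  induction s using Finset.induction_on with
  | empty => simp
  | insert i s hi ih =>
    rw [Finset.prod_insert hi, Finset.sum_insert hi, totalDegree_mul_of_isDomain
      (pow_ne_zero _ (hg i)) (Finset.prod_ne_zero_iff.2 fun j _ => pow_ne_zero _ (hg j)), ih, hpow]

/-- The degree of the polynomial obtained by substituting nonconstant polynomials in a polynomial
with a dominating monomial. -/
lemma totalDegree_aeval_of_dominating {p : MvPolynomial σ k} {e : σ →₀ ℕ} (he : coeff e p ≠ 0)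
    (hle : ∀ f, coeff f p ≠ 0 → f ≤ e) {g : σ → MvPolynomial σ k}
    (hg : ∀ i, 0 < (g i).totalDegree) :
    (aeval g p).totalDegree = ∑ i, e i * (g i).totalDegree := by
  classical
  have hg0 : ∀ i, g i ≠ 0 := fun i h => by simpa [h] using hg i
  have hterm : ∀ f (c : k), c ≠ 0 → (aeval g (monomial f c)).totalDegree
      = ∑ i, f i * (g i).totalDegree := fun f c hc => by
    rw [aeval_monomial, Finsupp.prod_fintype _ _ (by simp), algebraMap_eq,
      totalDegree_mul_of_isDomain (by simpa using hc)
      (Finset.prod_ne_zero_iff.2 fun j _ => pow_ne_zero _ (hg0 j)), totalDegree_C, zero_add,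
      totalDegree_prod_pow _ _ hg0]
  rw [← hterm e _ he]
  have hsplit : aeval g p = aeval g (monomial e (coeff e p))
      + ∑ f ∈ p.support.erase e, aeval g (monomial f (coeff f p)) := by
    rw [Finset.add_sum_erase _ (fun f => aeval g (monomial f (coeff f p))) (mem_support_iff.2 he),
      ← map_sum, support_sum_monomial_coeff]
  rcases (p.support.erase e).eq_empty_or_nonempty with h | ⟨f₀, hf₀⟩
  · rw [hsplit, h, Finset.sum_empty, add_zero]
  rw [hsplit]
  refine totalDegree_add_eq_left_of_totalDegree_lt ?_
  -- Some variable occurs less often in `f` than in `e`; as every `g i` is nonconstant, this costs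
  -- degree.
  have hlt : ∀ f ∈ p.support.erase e,
      (aeval g (monomial f (coeff f p))).totalDegree
        < (aeval g (monomial e (coeff e p))).totalDegree := fun f hf => by
    obtain ⟨hne, hf⟩ := Finset.mem_erase.1 hf
    rw [mem_support_iff] at hf
    rw [hterm e _ he, hterm f _ hf]
    have hfe := hle f hf
    obtain ⟨i, hi⟩ : ∃ i, f i < e i := by
      by_contra! h
      exact hne (le_antisymm hfe h)
    exact Finset.sum_lt_sum (fun i _ => Nat.mul_le_mul_right _ (hfe i))
      ⟨i, Finset.mem_univ i, Nat.mul_lt_mul_of_pos_right hi (hg i)⟩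
  refine lt_of_le_of_lt (totalDegree_finsetSum _ _) ?_
  exact (Finset.sup_lt_iff (lt_of_le_of_lt (Nat.zero_le _) (hlt f₀ hf₀))).2 hlt

end DominatingMonomial

namespace ModifiedQuantumWeylAlgebra

/-! ### The center for even `n`, and its automorphisms -/

section Center

open MvPolynomial

variable {k : Type*} [Field k] {n : ℕ} (a : Fin n → Fin n → k)

lemma mulSign_single_right (i : Fin n) (e : Fin n →₀ ℕ) :
    mulSign k e (Finsupp.single i 1) = (-1) ^ ∑ j ∈ Finset.Ioi i, e j := by
  rw [mulSign, ← Finset.prod_pow_eq_pow_sum]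
  refine (Finset.prod_subset (Finset.subset_univ (Finset.Ioi i)) fun j _ hj => ?_).symm.trans
    (Finset.prod_congr rfl fun j hj => ?_)
  · rw [belowSign_single, if_neg (by simpa using hj), one_pow]
  · rw [belowSign_single, if_pos (by simpa using hj), pow_one]

/-- Compare the coefficients of `x i * v` and `v * x i` at the top exponent `e + Finsupp.single i
1`. -/
lemma belowSign_eq_mulSign_of_central {v : QuantumWeyl a} (hv : ∀ u, u * v = v * u)
    {e : Fin n →₀ ℕ} (he : normalForm a v e ≠ 0)
    (hmax : ∀ g ∈ (normalForm a v).support, g.degree ≤ e.degree) (i : Fin n) :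
    belowSign k i e = mulSign k e (Finsupp.single i 1) := by
  have hi : ∀ g ∈ (normalForm a (gen a i)).support, g.degree ≤ 1 := fun g hg => by
    rw [normalForm_gen, Finsupp.support_single _ one_ne_zero, Finset.mem_singleton] at hg
    simp [hg]
  have h1 := normalForm_mul_apply_top a hi hmax (h := Finsupp.single i 1 + e) (by simp)
  have h2 := normalForm_mul_apply_top a hmax hi (h := e + Finsupp.single i 1) (by simp)
  rw [hv, add_comm, h2, normalForm_gen, Finsupp.support_single _ one_ne_zero] at h1
  simp only [Finset.sum_singleton, add_left_inj, Finset.sum_ite_eq',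
    Finsupp.mem_support_iff, ne_eq, he, not_false_eq_true, if_true, Finsupp.single_eq_same,
    mul_one, one_mul, add_comm (Finsupp.single i 1),
    mulSign_single_left] at h1
  exact (mul_left_cancel₀ he h1).symm

variable [CharZero k]

/-- Equality of the two signs says that `e.degree + e i` is even for each `i`. Summing over `i`,
with `n` even, shows that the degree is even, hence so is each `e i`. -/
lemma even_of_central (hn : Even n) {v : QuantumWeyl a} (hv : ∀ u, u * v = v * u)
    {e : Fin n →₀ ℕ} (he : normalForm a v e ≠ 0)
    (hmax : ∀ g ∈ (normalForm a v).support, g.degree ≤ e.degree) (i : Fin n) : Even (e i) := by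
  have h1 : ∀ i, Even (e.degree + e i) := fun i => by
    have h2 := belowSign_eq_mulSign_of_central a hv he hmax i
    have h3 : (-1 : k) ^ (∑ j ∈ Finset.Iio i, e j + ∑ j ∈ Finset.Ioi i, e j) = 1 := by
      rw [pow_add, ← mulSign_single_right, ← h2, belowSign, ← mul_pow]
      simp
    have h4 : Even (∑ j ∈ Finset.Iio i, e j + ∑ j ∈ Finset.Ioi i, e j) := by
      by_contra h
      rw [Nat.not_even_iff_odd] at h
      rw [h.neg_one_pow] at h3
      norm_num [neg_eq_iff_add_eq_zero] at h3
    have h5 : e.degree = ∑ j ∈ Finset.Iio i, e j + e i + ∑ j ∈ Finset.Ioi i, e j := by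
      rw [Finsupp.degree_eq_sum, ← Finset.sum_subset (Finset.subset_univ
        (Finset.Iio i ∪ {i} ∪ Finset.Ioi i)), Finset.sum_union, Finset.sum_union,
        Finset.sum_singleton]
      · simp
      · rw [Finset.disjoint_left]
        intro j hj hj'
        simp only [Finset.mem_union, Finset.mem_Iio, Finset.mem_singleton, Finset.mem_Ioi] at hj hj'
        exact absurd hj' (not_lt_of_ge (hj.elim le_of_lt le_of_eq))
      · intro j _ hj
        simp only [Finset.mem_union, Finset.mem_Iio, Finset.mem_singleton, Finset.mem_Ioi] at hj
        exact absurd (lt_trichotomy j i) (by tauto)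
    rw [h5]
    have h6 := h4.add (even_two_mul (e i))
    rwa [two_mul, ← add_assoc, add_right_comm (∑ j ∈ Finset.Iio i, e j)] at h6
  have h2 : Even (∑ i, (e.degree + e i)) := Finset.even_sum _ fun i _ => h1 i
  rw [Finset.sum_add_distrib, ← Finsupp.degree_eq_sum, Finset.sum_const, Finset.card_univ,
    Fintype.card_fin, smul_eq_mul] at h2
  have h3 : Even e.degree := (Nat.even_add.1 h2).1 (hn.mul_right _)
  exact (Nat.even_add.1 (h1 i)).1 h3

omit [CharZero k] in
lemma algebraMap_monomial (f : Fin n →₀ ℕ) (c : k) :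
    algebraMap (MvPolynomial (Fin n) k) (QuantumWeyl a) (monomial f c)
      = c • orderedMonomial a (2 • f) := by
  have := monomial_smul_orderedMonomial a f 0 c
  rwa [orderedMonomial_zero, add_zero, ← Algebra.algebraMap_eq_smul_one] at this

/-- In an even number of variables, the center consists of the polynomials in the squares of the
generators. -/
lemma exists_algebraMap_eq_of_central (hn : Even n) {v : QuantumWeyl a}
    (hv : ∀ u, u * v = v * u) :
    ∃ r, algebraMap (MvPolynomial (Fin n) k) (QuantumWeyl a) r = v := by
  induction hN : (normalForm a v).support.card using Nat.strong_induction_on generalizing v with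
  | _ N ih =>
    rcases (normalForm a v).support.eq_empty_or_nonempty with h0 | h0
    · refine ⟨0, ?_⟩
      rw [map_zero]
      apply normalForm_injective a
      rw [map_zero, Finsupp.support_eq_empty.1 h0]
    · obtain ⟨e, he, hmax⟩ := Finset.exists_max_image _ Finsupp.degree h0
      have heven := even_of_central a hn hv (Finsupp.mem_support_iff.1 he) hmax
      let f : Fin n →₀ ℕ := e.mapRange (· / 2) rfl
      have hf : 2 • f = e := Finsupp.ext fun i => by
        simpa [f] using Nat.two_mul_div_two_of_even (heven i)
      let r : MvPolynomial (Fin n) k := monomial f (normalForm a v e)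
      -- The image of a monomial is a single ordered monomial, so subtracting it removes one
      -- exponent and adds none.
      have hr : normalForm a (v - algebraMap (MvPolynomial (Fin n) k) (QuantumWeyl a) r)
          = (normalForm a v).erase e := by
        rw [map_sub, algebraMap_monomial, map_smul, normalForm_orderedMonomial, hf,
          Finsupp.erase_eq_sub_single, Finsupp.smul_single, smul_eq_mul, mul_one]
      obtain ⟨s, hs⟩ := ih _ (by
        rw [hr, Finsupp.support_erase, ← hN]
        exact Finset.card_erase_lt_of_mem he) (v := v - algebraMap _ _ r)
        (fun u => by rw [mul_sub, sub_mul, hv, Algebra.commutes]) rfl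
      exact ⟨s + r, by rw [map_add, hs, sub_add_cancel]⟩

/-- The automorphism of the polynomial ring induced by an automorphism of the algebra. -/
lemma exists_centerAut (hn : Even n) (τ : QuantumWeyl a ≃ₐ[k] QuantumWeyl a) :
    ∃ ψ : MvPolynomial (Fin n) k ≃ₐ[k] MvPolynomial (Fin n) k, ∀ r,
      τ (algebraMap _ _ r) = algebraMap (MvPolynomial (Fin n) k) (QuantumWeyl a) (ψ r) := by
  have key : ∀ τ : QuantumWeyl a ≃ₐ[k] QuantumWeyl a,
      ∃ ψ : MvPolynomial (Fin n) k →ₐ[k] MvPolynomial (Fin n) k, ∀ r,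
        τ (algebraMap _ _ r) = algebraMap (MvPolynomial (Fin n) k) (QuantumWeyl a) (ψ r) := by
    intro τ
    have h : ∀ r : MvPolynomial (Fin n) k, ∃ s, algebraMap (MvPolynomial (Fin n) k) (QuantumWeyl a) s
        = τ (algebraMap _ _ r) := fun r =>
      exists_algebraMap_eq_of_central a hn fun u => by
        obtain ⟨w, rfl⟩ := τ.surjective u
        rw [← map_mul, ← map_mul, Algebra.commutes]
    choose ψ hψ using h
    have hinj := algebraMap_injective a
    exact ⟨{  toFun := ψ
              map_one' := hinj (by rw [hψ]; simp)
              map_zero' := hinj (by rw [hψ]; simp)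
              map_mul' := fun r s => hinj (by simp [hψ])
              map_add' := fun r s => hinj (by simp [hψ])
              commutes' := fun c => hinj (by
                rw [hψ, ← IsScalarTower.algebraMap_apply, AlgEquiv.commutes]) },
      fun r => (hψ r).symm⟩
  obtain ⟨ψ, hψ⟩ := key τ
  obtain ⟨ψ', hψ'⟩ := key τ.symm
  refine ⟨AlgEquiv.ofAlgHom ψ ψ' ?_ ?_, hψ⟩
  · refine AlgHom.ext fun r => algebraMap_injective a ?_
    simp [← hψ, ← hψ']
  · refine AlgHom.ext fun r => algebraMap_injective a ?_
    simp [← hψ, ← hψ']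

/-- The discriminant `D` has degree `∑ i, e i` and its image has degree `∑ i, e i * deg (ψ (X i))`,
where `e` is the dominating exponent. These agree because `ψ D` is a unit times `D`; as all `e i`
are positive and all degrees at least 1, every degree is 1. -/
lemma totalDegree_centerAut (τ : QuantumWeyl a ≃ₐ[k] QuantumWeyl a)
    (ψ : MvPolynomial (Fin n) k ≃ₐ[k] MvPolynomial (Fin n) k)
    (h : ∀ r, τ (algebraMap _ _ r) = algebraMap (MvPolynomial (Fin n) k) (QuantumWeyl a) (ψ r))
    (i : Fin n) : (ψ (X i)).totalDegree = 1 := by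
  have hpos : ∀ i, 0 < (ψ (X i)).totalDegree := fun i => by
    rw [Nat.pos_iff_ne_zero]
    intro h0
    rw [totalDegree_eq_zero_iff_eq_C] at h0
    have h1 : X i = (C (coeff 0 (ψ (X i))) : MvPolynomial (Fin n) k) := by
      apply ψ.injective
      conv_lhs => rw [h0]
      exact (ψ.commutes _).symm
    have h2 := congrArg totalDegree h1
    simp at h2
  obtain ⟨u, hu, hD⟩ := exists_isUnit_map_traceDiscr (squarefreeBasis a) τ.toRingEquiv
    ψ.toRingEquiv h
  have hne := coeff_traceDiscr_ne_zero a
  have hle := fun f => le_of_coeff_traceDiscr_ne_zero a (f := f)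
  have hD0 : traceDiscr (squarefreeBasis a) ≠ 0 := fun h => hne (by rw [h, coeff_zero])
  have h1 := totalDegree_aeval_of_dominating hne hle (g := fun i => ψ (X i)) hpos
  have h2 := totalDegree_aeval_of_dominating hne hle (g := X) (by simp)
  have h3 : aeval (fun i => ψ (X i)) (traceDiscr (squarefreeBasis a))
      = u * traceDiscr (squarefreeBasis a) := by
    rw [← hD]
    exact (DFunLike.congr_fun (aeval_unique ψ.toAlgHom) _).symm
  rw [h3, totalDegree_mul_of_isDomain hu.ne_zero hD0,
    (isUnit_iff_totalDegree_of_isReduced.1 hu).2, zero_add] at h1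
  rw [aeval_X_left_apply, h1] at h2
  have h4 := (Finset.sum_eq_sum_iff_of_le fun i _ => Nat.mul_le_mul_left (discrExponent n i)
    (by rw [totalDegree_X]; exact hpos i : (X i : MvPolynomial (Fin n) k).totalDegree ≤ _)).1 h2.symm i
    (Finset.mem_univ i)
  have h5 := Nat.eq_of_mul_eq_mul_left (discrExponent_pos i) h4
  rw [← h5, totalDegree_X]

end Center

end ModifiedQuantumWeylAlgebra

namespace ModifiedQuantumWeylAlgebra

/-! ### Automorphisms permute the generators up to scalars -/

section Monomial

open MvPolynomial

variable {k : Type*} [Field k] {n : ℕ} (a : Fin n → Fin n → k)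

lemma exists_of_normalForm_algebraMap_ne_zero {r : MvPolynomial (Fin n) k} {e : Fin n →₀ ℕ}
    (h : normalForm a (algebraMap _ _ r) e ≠ 0) : ∃ f, coeff f r ≠ 0 ∧ e = 2 • f := by
  obtain ⟨f, S, rfl⟩ := exists_eq_two_smul_add_squarefreeExponent e
  have h0 : squarefreeExponent (∅ : Finset (Fin n)) = 0 := by ext; simp
  have h1 := normalForm_smul_apply a r S ∅ f
  rw [h0, orderedMonomial_zero, ← Algebra.algebraMap_eq_smul_one] at h1
  rw [h1] at h
  obtain ⟨rfl, h2⟩ := ite_ne_right_iff.1 h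
  exact ⟨f, h2, by rw [h0, add_zero]⟩

/-- Signs could cause cancellation in the top part of `v * v`. Unique sums in the exponent monoid
provide a pair of top exponents whose product meets no other, so `v * v` has a term of twice the
degree of `v`; it lies in the polynomial ring, where `X i` counts twice. -/
lemma degree_le_one_of_sq {v : QuantumWeyl a} {r : MvPolynomial (Fin n) k}
    (hv : v * v = algebraMap _ _ r) (hr : r.totalDegree ≤ 1) {g : Fin n →₀ ℕ}
    (hg : normalForm a v g ≠ 0) : g.degree ≤ 1 := by
  obtain ⟨e, he, hmax⟩ := Finset.exists_max_image (normalForm a v).support Finsupp.degree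
    ⟨g, Finsupp.mem_support_iff.2 hg⟩
  refine (hmax g (Finsupp.mem_support_iff.2 hg)).trans ?_
  set A := (normalForm a v).support.filter fun g => g.degree = e.degree with hA
  have hA0 : A.Nonempty := ⟨e, Finset.mem_filter.2 ⟨he, rfl⟩⟩
  obtain ⟨x, hx, y, hy, hxy⟩ := UniqueSums.uniqueAdd_of_nonempty hA0 hA0
  obtain ⟨hx0, hx1⟩ := Finset.mem_filter.1 hx
  obtain ⟨hy0, hy1⟩ := Finset.mem_filter.1 hy
  have h1 := normalForm_mul_apply_top a hmax hmax (h := x + y) (by simp [hx1, hy1])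
  have h2 : ∀ p ∈ (normalForm a v).support, ∀ q ∈ (normalForm a v).support,
      p + q = x + y → p = x ∧ q = y := fun p hp q hq hpq => by
    have h3 := congrArg Finsupp.degree hpq
    rw [map_add, map_add, hx1, hy1] at h3
    have h4 := hmax p hp
    have h5 := hmax q hq
    exact hxy (Finset.mem_filter.2 ⟨hp, by omega⟩) (Finset.mem_filter.2 ⟨hq, by omega⟩) hpq
  rw [Finset.sum_eq_single_of_mem x hx0 fun p hp hne => Finset.sum_eq_zero fun q hq =>
      if_neg fun h => hne (h2 p hp q hq h).1,
    Finset.sum_eq_single_of_mem y hy0 fun q hq hne => if_neg fun h => hne (h2 x hx0 q hq h).2,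
    if_pos rfl, hv] at h1
  have h3 : normalForm a (algebraMap _ _ r) (x + y) ≠ 0 := by
    rw [h1]
    exact mul_ne_zero (mul_ne_zero (Finsupp.mem_support_iff.1 hx0) (Finsupp.mem_support_iff.1 hy0))
      (mulSign_ne_zero x y)
  obtain ⟨f, hf, h4⟩ := exists_of_normalForm_algebraMap_ne_zero a h3
  have h5 : f.degree ≤ 1 := (le_totalDegree (mem_support_iff.2 hf)).trans hr
  have h6 := congrArg Finsupp.degree h4
  rw [map_add, map_nsmul, hx1, hy1, smul_eq_mul] at h6
  omega

lemma eq_sum_smul_gen_add {v : QuantumWeyl a} (h : ∀ g, normalForm a v g ≠ 0 → g.degree ≤ 1) :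
    ∃ (r : Fin n → k) (s : k), v = ∑ l, r l • gen a l + algebraMap k _ s := by
  refine ⟨fun l => normalForm a v (Finsupp.single l 1), normalForm a v 0,
    normalForm_injective a (Finsupp.ext fun g => ?_)⟩
  rw [Algebra.algebraMap_eq_smul_one, LinearMap.map_add, map_sum, map_smul, normalForm_one,
    Finsupp.add_apply, Finsupp.finsetSum_apply]
  simp only [map_smul, normalForm_gen, Finsupp.smul_apply, smul_eq_mul]
  by_cases hg : g.degree = 0
  · rw [Finsupp.degree_eq_zero_iff] at hg
    subst hg
    rw [Finset.sum_eq_zero, zero_add, Finsupp.single_eq_same, mul_one]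
    intro l _
    rw [Finsupp.single_eq_of_ne (by simp [eq_comm]), mul_zero]
  have hg0 : g ≠ 0 := fun h => hg (by rw [h, map_zero])
  rw [Finsupp.single_eq_of_ne hg0, mul_zero, add_zero]
  by_cases hg1 : g.degree = 1
  · obtain ⟨i, hi⟩ : ∃ i, g i ≠ 0 := by
      by_contra! h
      exact hg0 (Finsupp.ext h)
    obtain ⟨d, hd⟩ := exists_add_of_le (Finsupp.single_le_iff.2 (Nat.one_le_iff_ne_zero.2 hi))
    have h1 : d.degree = 0 := by
      rw [hd, map_add, Finsupp.degree_single] at hg1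
      omega
    rw [Finsupp.degree_eq_zero_iff] at h1
    rw [h1, add_zero] at hd
    rw [hd, Finset.sum_eq_single i, Finsupp.single_eq_same, mul_one]
    · intro l _ hl
      rw [Finsupp.single_eq_of_ne, mul_zero]
      exact fun h => hl (Finsupp.single_left_injective one_ne_zero h).symm
    · simp
  · rw [Finset.sum_eq_zero]
    · by_contra h0
      have := h g h0
      omega
    · intro l _
      rw [Finsupp.single_eq_of_ne, mul_zero]
      rintro rfl
      simp at hg1

lemma algebraMap_C (c : k) :
    algebraMap (MvPolynomial (Fin n) k) (QuantumWeyl a) (C c) = algebraMap k _ c :=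
  (IsScalarTower.algebraMap_apply k _ _ c).symm

/-- The anticommutator of two linear forms in the generators. -/
noncomputable def anticommPoly (r s : Fin n → k) : MvPolynomial (Fin n) k :=
  ∑ l, ∑ m, C (r l * s m) * if l = m then C 2 * X l else C (sym a l m)

lemma algebraMap_anticommPoly (r s : Fin n → k) :
    algebraMap _ (QuantumWeyl a) (anticommPoly a r s) =
      (∑ l, r l • gen a l) * (∑ l, s l • gen a l) + (∑ l, s l • gen a l) * ∑ l, r l • gen a l := by
  rw [Finset.sum_mul_sum, Finset.sum_mul_sum, Finset.sum_comm (f := fun i j => s i • _ * _),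
    ← Finset.sum_add_distrib, anticommPoly, map_sum]
  refine Finset.sum_congr rfl fun l _ => ?_
  rw [← Finset.sum_add_distrib, map_sum]
  refine Finset.sum_congr rfl fun m _ => ?_
  rw [map_mul, algebraMap_C, smul_mul_smul_comm, smul_mul_smul_comm, mul_comm (s m), ← smul_add,
    ← Algebra.smul_def]
  congr 1
  split_ifs with h
  · subst h
    rw [map_mul, algebraMap_X, algebraMap_C, map_ofNat, two_mul, sq]
  · rw [algebraMap_C, gen_mul_gen_add a h]

lemma coeff_anticommPoly (r s : Fin n → k) (l : Fin n) :
    coeff (Finsupp.single l 1) (anticommPoly a r s) = 2 * (r l * s l) := by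
  have h1 : ∀ i : Fin n, (0 : Fin n →₀ ℕ) ≠ Finsupp.single i 1 := fun i => by simp [eq_comm]
  simp only [anticommPoly, coeff_sum, coeff_C_mul]
  rw [Finset.sum_eq_single l]
  · rw [Finset.sum_eq_single l]
    · rw [if_pos rfl, coeff_C_mul, coeff_X, if_pos rfl]
      ring
    · intro m _ hm
      rw [if_neg hm.symm, coeff_C, if_neg (h1 l), mul_zero]
    · simp
  · intro m _ hm
    refine Finset.sum_eq_zero fun m' _ => ?_
    split_ifs
    · rw [coeff_C_mul, coeff_X, if_neg, mul_zero, mul_zero]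
      exact fun h => hm (Finsupp.single_left_injective one_ne_zero h)
    · rw [coeff_C, if_neg (h1 l), mul_zero]
  · simp

variable [CharZero k]

omit [CharZero k] in
lemma two_mul_add_algebraMap_sq {A : Type*} [Ring A] [Algebra k A] (x : A) (s : k) :
    2 * ((x + algebraMap k A s) * (x + algebraMap k A s))
      = x * x + x * x + (4 * s) • x + algebraMap k A (2 * s * s) := by
  have h := Algebra.commutes s x
  rw [Algebra.smul_def, map_mul, map_mul, map_mul, map_ofNat, map_ofNat, add_mul, mul_add, mul_add,
    ← h]
  noncomm_ring

/-- Write `v = ℓ + s` with `ℓ` a linear form. In `2 * v ^ 2` everything but `4 * s • ℓ` is known to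
be a polynomial in the squares, so `s • ℓ = 0`. If `s ≠ 0`, then `v` is a scalar and its square
cannot have degree 1. -/
lemma eq_sum_smul_gen_of_sq {v : QuantumWeyl a} {q : MvPolynomial (Fin n) k}
    (hv : v * v = algebraMap _ _ q) (hq : q.totalDegree = 1) :
    ∃ r : Fin n → k, v = ∑ l, r l • gen a l := by
  obtain ⟨r, s, h⟩ := eq_sum_smul_gen_add a fun g => degree_le_one_of_sq a hv hq.le
  refine ⟨r, ?_⟩
  have h3 : ∀ l, s * r l = 0 := fun l => by
    have h4 : algebraMap _ (QuantumWeyl a) (C 2 * q - anticommPoly a r r - C (2 * s * s))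
        = (4 * s) • ∑ l, r l • gen a l := by
      rw [map_sub, map_sub, algebraMap_anticommPoly, map_mul, ← hv, h, algebraMap_C, algebraMap_C,
        map_ofNat, two_mul_add_algebraMap_sq]
      abel
    by_contra h0
    have h5 : normalForm a (algebraMap _ _ (C 2 * q - anticommPoly a r r - C (2 * s * s)))
        (Finsupp.single l 1) = 4 * s * r l := by
      rw [h4, map_smul, map_sum, Finsupp.smul_apply, Finsupp.finsetSum_apply,
        Finset.sum_eq_single l]
      · simp [normalForm_gen, mul_assoc]
      · intro m _ hm
        rw [map_smul, normalForm_gen, Finsupp.smul_apply, Finsupp.single_eq_of_ne, smul_zero]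
        exact fun h => hm (Finsupp.single_left_injective one_ne_zero h).symm
      · simp
    obtain ⟨f, -, hf⟩ := exists_of_normalForm_algebraMap_ne_zero a
      (h5.trans_ne (by rw [mul_assoc]; exact mul_ne_zero (by norm_num) h0))
    have h6 := congrArg Finsupp.degree hf
    rw [Finsupp.degree_single, map_nsmul, smul_eq_mul] at h6
    omega
  rcases eq_or_ne s 0 with rfl | hs
  · rw [h, map_zero, add_zero]
  · exfalso
    have h4 : ∀ l, r l = 0 := fun l => (mul_eq_zero.1 (h3 l)).resolve_left hs
    rw [Finset.sum_eq_zero fun l _ => by rw [h4, zero_smul], zero_add] at h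
    have h5 : algebraMap (MvPolynomial (Fin n) k) (QuantumWeyl a) (C (s * s))
        = algebraMap _ _ q := by
      rw [← hv, h, ← map_mul, algebraMap_C]
    have h6 := congrArg totalDegree (algebraMap_injective a h5)
    rw [totalDegree_C, hq] at h6
    exact zero_ne_one h6

/-- In an even number of variables, an automorphism permutes the generators up to scalars. -/
theorem exists_perm_of_even (hn : Even n) (τ : QuantumWeyl a ≃ₐ[k] QuantumWeyl a) :
    ∃ (σ : Equiv.Perm (Fin n)) (r : Fin n → kˣ), ∀ i, τ (gen a i) = (r i : k) • gen a (σ i) := by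
  obtain ⟨ψ, hψ⟩ := exists_centerAut a hn τ
  have h1 : ∀ i, ∃ r : Fin n → k, τ (gen a i) = ∑ l, r l • gen a l := fun i =>
    eq_sum_smul_gen_of_sq a (q := ψ (X i)) (by rw [← hψ, algebraMap_X a, map_pow, sq])
      (totalDegree_centerAut a τ ψ hψ i)
  choose r hr using h1
  have h2 : ∀ i, ∃ l, r i l ≠ 0 := fun i => by
    by_contra! h0
    have h3 := hr i
    rw [Finset.sum_eq_zero fun l _ => by rw [h0, zero_smul]] at h3
    have h4 := congrArg (normalForm a) ((map_eq_zero_iff τ τ.injective).1 h3)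
    simp [normalForm_gen] at h4
  -- The anticommutator of the images is a scalar, while its coefficient at `X l` is `2 * (r i l * r
  -- j l)`. The rows of coefficients thus have disjoint nonempty supports, which leaves one entry in
  -- each.
  have h3 : ∀ i j l, i ≠ j → r i l * r j l = 0 := fun i j l hij => by
    have h4 : algebraMap (MvPolynomial (Fin n) k) (QuantumWeyl a) (anticommPoly a (r i) (r j))
        = algebraMap (MvPolynomial (Fin n) k) (QuantumWeyl a) (C (sym a i j)) := by
      rw [algebraMap_anticommPoly, ← hr, ← hr, ← map_mul, ← map_mul, ← map_add,
        gen_mul_gen_add a hij, AlgEquiv.commutes]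
      exact (algebraMap_C a _).symm
    have h5 := congrArg (coeff (Finsupp.single l 1)) (algebraMap_injective a h4)
    rw [coeff_anticommPoly, coeff_C, if_neg (by simp [eq_comm])] at h5
    exact (mul_eq_zero.1 h5).resolve_left two_ne_zero
  choose σ hσ using h2
  have hσinj : Function.Injective σ := fun i j hij => by
    by_contra hne
    exact mul_ne_zero (hσ i) (hij ▸ hσ j) (h3 i j (σ i) hne)
  refine ⟨Equiv.ofBijective σ (Finite.injective_iff_bijective.1 hσinj),
    fun i => Units.mk0 _ (hσ i), fun i => ?_⟩
  rw [hr, Finset.sum_eq_single (σ i)]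
  · rfl
  · intro l _ hl
    obtain ⟨j, rfl⟩ := (Finite.injective_iff_surjective.1 hσinj) l
    have hij : i ≠ j := fun h => hl (h ▸ rfl)
    rw [(mul_eq_zero.1 (h3 i j (σ j) hij)).resolve_right (hσ j), zero_smul]
  · simp

end Monomial

end ModifiedQuantumWeylAlgebra

/-! ### Counting permutations that respect a partition -/

section SetoidPerm

variable {α : Type*} [Fintype α] (s : Setoid α)

/-- If all classes of a setoid have at least three elements, then few permutations respect it: they
meet trivially a group that permutes two of three representatives of each class. -/
lemma Setoid.card_perm_mul_factorial_sq_le (h3 : ∀ i j, ∃ m, s m i ∧ m ≠ i ∧ m ≠ j) :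
    Nat.card {σ : Equiv.Perm α // ∀ i j, s i j ↔ s (σ i) (σ j)} * (Nat.card (Quotient s))! ^ 2
      ≤ (Nat.card α)! := by
  classical
  let u : Quotient s → α := Quotient.out
  have hu : ∀ q, (⟦u q⟧ : Quotient s) = q := Quotient.out_eq
  choose v hv hvu _ using fun q => h3 (u q) (u q)
  choose w hw hwu hwv using fun q => h3 (u q) (v q)
  have hv' : ∀ q, (⟦v q⟧ : Quotient s) = q := fun q => (Quotient.sound (hv q)).trans (hu q)
  have hw' : ∀ q, (⟦w q⟧ : Quotient s) = q := fun q => (Quotient.sound (hw q)).trans (hu q)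
  have hsep : ∀ {x y : Quotient s → α}, (∀ q, (⟦x q⟧ : Quotient s) = q) →
      (∀ q, (⟦y q⟧ : Quotient s) = q) → ∀ {p q}, x p = y q → p = q :=
    fun hx hy p q h => by rw [← hx p, h, hy]
  let f : Quotient s ⊕ Quotient s ↪ α := ⟨Sum.elim v w, by
    rintro (p | p) (q | q) h
    · exact congrArg _ (hsep hv' hv' h)
    · have := hsep hv' hw' h
      subst this
      exact absurd h.symm (hwv p)
    · have := hsep hw' hv' h
      subst this
      exact absurd h (hwv p)
    · exact congrArg _ (hsep hw' hw' h)⟩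
  let E : Equiv.Perm (Quotient s) × Equiv.Perm (Quotient s) →* Equiv.Perm α :=
    (Equiv.Perm.viaEmbeddingHom f).comp (Equiv.Perm.sumCongrHom _ _)
  have hEu : ∀ p q, E p (u q) = u q := fun p q => by
    refine Equiv.Perm.viaEmbedding_apply_of_notMem _ f _ ?_
    rintro ⟨r | r, hr⟩
    · have := hsep hv' hu hr
      subst this
      exact hvu r hr
    · have := hsep hw' hu hr
      subst this
      exact hwu r hr
  have hEv : ∀ p q, E p (v q) = v (p.1 q) := fun p q =>
    Equiv.Perm.viaEmbedding_apply _ f (Sum.inl q)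
  have hEw : ∀ p q, E p (w q) = w (p.2 q) := fun p q =>
    Equiv.Perm.viaEmbedding_apply _ f (Sum.inr q)
  -- `E p` fixes the representative `u q`, so if it respects the classes it maps each class to
  -- itself and cannot move `v q` or `w q` to another class.
  have hE : ∀ p, (∀ i j, s i j ↔ s (E p i) (E p j)) → p = 1 := fun p hp => by
    ext q
    · have h1 := (hp _ _).1 (hv q)
      rw [hEu, hEv] at h1
      have h2 : (⟦v (p.1 q)⟧ : Quotient s) = ⟦u q⟧ := Quotient.sound h1
      rw [hv', hu] at h2
      exact h2
    · have h1 := (hp _ _).1 (hw q)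
      rw [hEu, hEw] at h1
      have h2 : (⟦w (p.2 q)⟧ : Quotient s) = ⟦u q⟧ := Quotient.sound h1
      rw [hw', hu] at h2
      exact h2
  let F : {σ : Equiv.Perm α // ∀ i j, s i j ↔ s (σ i) (σ j)} ×
      (Equiv.Perm (Quotient s) × Equiv.Perm (Quotient s)) → Equiv.Perm α :=
    fun p => E p.2 * p.1.1
  have hF : Function.Injective F := by
    rintro ⟨⟨σ, hσ⟩, p⟩ ⟨⟨σ', hσ'⟩, p'⟩ h
    change E p * σ = E p' * σ' at h
    have h1 : E (p'⁻¹ * p) = σ' * σ⁻¹ := by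
      rw [map_mul, map_inv, inv_mul_eq_iff_eq_mul, ← mul_assoc, ← h, mul_inv_cancel_right]
    have h2 := hE (p'⁻¹ * p) fun i j => by
      rw [h1, Equiv.Perm.mul_apply, Equiv.Perm.mul_apply, ← hσ', hσ (σ⁻¹ i)]
      simp
    have h3 : p = p' := (inv_mul_eq_one.1 h2).symm
    subst h3
    have h4 := mul_left_cancel h
    subst h4
    rfl
  have hcard := Nat.card_le_card_of_injective F hF
  rwa [Nat.card_prod, Nat.card_prod, Nat.card_perm, Nat.card_perm, ← sq] at hcard

end SetoidPerm

/-! ### Counting permutations and rescalings of a symmetric family -/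

section Rescaling

variable {k : Type*} [Field k] [CharZero k] {n : ℕ} (c : Fin n → Fin n → k)

instance : Infinite kˣ :=
  Infinite.of_injective (fun m : ℕ => Units.mk0 ((m : k) + 1) (Nat.cast_add_one_ne_zero m))
    fun m m' h => by simpa using congrArg Units.val h

/-- The permutations and rescalings of the variables that preserve the relations. -/
def Rescales (σ : Equiv.Perm (Fin n)) (r : Fin n → kˣ) : Prop :=
  ∀ i j, i ≠ j → (r i : k) * r j * c (σ i) (σ j) = c i j

/-- The rescalings of the variables that preserve the relations. -/
def rescalings : Set (Fin n → kˣ) := {r | ∀ i j, i ≠ j → c i j ≠ 0 → r i * r j = 1}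

variable {c}

omit [CharZero k] in
lemma Rescales.mul_eq {σ : Equiv.Perm (Fin n)} {r : Fin n → kˣ} (h : Rescales c σ r)
    (i j : Fin n) (hij : i ≠ j) : (r i : k) * r j * c (σ i) (σ j) = c i j :=
  h i j hij

omit [CharZero k] in
lemma Rescales.ne_zero_iff {σ : Equiv.Perm (Fin n)} {r : Fin n → kˣ} (h : Rescales c σ r)
    {i j : Fin n} (hij : i ≠ j) : c (σ i) (σ j) ≠ 0 ↔ c i j ≠ 0 := by
  rw [← h i j hij]
  simp

omit [CharZero k] in
lemma rescales_one_of_mem {r : Fin n → kˣ} (hr : r ∈ rescalings c) : Rescales c 1 r := by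
  intro i j hij
  by_cases h : c i j = 0
  · simp [h]
  · have := hr i j hij h
    rw [← Units.val_mul, this]
    simp

omit [CharZero k] in
lemma Rescales.div_mem {σ : Equiv.Perm (Fin n)} {r r' : Fin n → kˣ} (h : Rescales c σ r)
    (h' : Rescales c σ r') : r / r' ∈ rescalings c := by
  intro i j hij hc
  have h0 : c (σ i) (σ j) ≠ 0 := (h.ne_zero_iff hij).2 hc
  have h1 : (r i : k) * r j = r' i * r' j :=
    mul_right_cancel₀ h0 ((h i j hij).trans (h' i j hij).symm)
  rw [Pi.div_apply, Pi.div_apply, div_mul_div_comm, div_eq_one]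
  exact Units.ext h1

lemma infinite_of_forall_mem {i : Fin n} (g : kˣ → Fin n → kˣ) (hg : ∀ x, g x ∈ rescalings c)
    (hi : ∀ x, g x i = x) : (rescalings c).Infinite :=
  Set.infinite_of_injective_forall_mem (f := g)
    (fun x y h => by rw [← hi x, h, hi]) hg

/-- If `r i` is not its own inverse, replacing the value `r i` by `y`, the value `(r i)⁻¹` by `y⁻¹`
and all others by 1 gives a rescaling for every `y`. -/
lemma mul_self_eq_one_of_mem (hfin : (rescalings c).Finite) {r : Fin n → kˣ}
    (hr : r ∈ rescalings c) (i : Fin n) : r i * r i = 1 := by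
  classical
  by_contra h
  have hne : (r i)⁻¹ ≠ r i := fun h' => h (by
    nth_rewrite 1 [← h']
    exact inv_mul_cancel _)
  let f : kˣ → kˣ → kˣ := fun y x => if x = r i then y else if x = (r i)⁻¹ then y⁻¹ else 1
  have hf : ∀ y x, f y x * f y x⁻¹ = 1 := by
    intro y x
    simp only [f, inv_eq_iff_eq_inv, inv_inv]
    by_cases h1 : x = r i
    · subst h1
      simp [hne.symm]
    · by_cases h2 : x = (r i)⁻¹
      · subst h2
        simp [hne]
      · simp [h1, h2]
  refine infinite_of_forall_mem (i := i) (fun y j => f y (r j)) (fun y p q hpq hc => ?_)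
    (fun y => by simp [f]) hfin
  have h1 : r q = (r p)⁻¹ := (inv_eq_of_mul_eq_one_right (hr p q hpq hc)).symm
  dsimp only
  rw [h1]
  exact hf y (r p)

variable (c) in
/-- Two indices are related if no rescaling distinguishes them. -/
def rescalingSetoid : Setoid (Fin n) where
  r i j := ∀ r ∈ rescalings c, r i = r j
  iseqv := ⟨fun _ _ _ => rfl, fun h r hr => (h r hr).symm, fun h h' r hr =>
    (h r hr).trans (h' r hr)⟩

lemma rescalingSetoid_of_ne_zero (hfin : (rescalings c).Finite) {i j : Fin n} (hij : i ≠ j)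
    (hc : c i j ≠ 0) : rescalingSetoid c i j := fun r hr =>
  mul_right_cancel (b := r j)
    ((hr i j hij hc).trans (mul_self_eq_one_of_mem hfin hr j).symm)

/-- Indices with a nonzero scalar between them lie in one class. If the class of `i` were contained
in `{i, j}`, the value `y` at `i`, `y⁻¹` at `j` (when `j` is another element of the class) and 1
elsewhere would be a rescaling for every `y`. -/
lemma exists_third (hfin : (rescalings c).Finite) (i j : Fin n) :
    ∃ m, rescalingSetoid c m i ∧ m ≠ i ∧ m ≠ j := by
  classical
  by_contra! h
  refine infinite_of_forall_mem (i := i) (fun y m => if m = i then y else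
    if m = j ∧ rescalingSetoid c j i then y⁻¹ else 1) (fun y p q hpq hc => ?_)
    (fun y => by simp) hfin
  have hs := rescalingSetoid_of_ne_zero hfin hpq hc
  dsimp only
  by_cases hp : p = i
  · subst hp
    have hq : q = j := h q ((rescalingSetoid c).symm' hs) hpq.symm
    subst hq
    rw [if_pos rfl, if_neg hpq.symm, if_pos ⟨rfl, (rescalingSetoid c).symm' hs⟩, mul_inv_cancel]
  · by_cases hp' : p = j ∧ rescalingSetoid c j i
    · obtain ⟨rfl, hji⟩ := hp'
      have hq : q = i := by
        by_contra hq
        exact hpq.symm (h q ((rescalingSetoid c).trans' ((rescalingSetoid c).symm' hs) hji) hq)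
      subst hq
      rw [if_neg hp, if_pos ⟨rfl, hji⟩, if_pos rfl, inv_mul_cancel]
    · have hpi : ¬ rescalingSetoid c p i := fun h' => hp' (by
        have := h p h' hp
        subst this
        exact ⟨rfl, h'⟩)
      have hqi : ¬ rescalingSetoid c q i := fun h' => hpi ((rescalingSetoid c).trans' hs h')
      rw [if_neg hp, if_neg hp', if_neg (by rintro rfl; exact hqi ((rescalingSetoid c).refl' q)),
        if_neg (by rintro ⟨rfl, h'⟩; exact hqi h'), mul_one]

omit [CharZero k] in
lemma Rescales.setoid_iff {σ : Equiv.Perm (Fin n)} {r : Fin n → kˣ} (h : Rescales c σ r)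
    (i j : Fin n) : rescalingSetoid c i j ↔ rescalingSetoid c (σ i) (σ j) := by
  constructor
  · intro hij t ht
    refine hij (fun m => t (σ m)) fun p q hpq hc => ?_
    exact ht _ _ (σ.injective.ne hpq) ((h.ne_zero_iff hpq).2 hc)
  · intro hij t ht
    have := hij (fun m => t (σ⁻¹ m)) fun p q hpq hc => by
      have hpq' : σ⁻¹ p ≠ σ⁻¹ q := σ⁻¹.injective.ne hpq
      refine ht _ _ hpq' ((h.ne_zero_iff hpq').1 ?_)
      simpa using hc
    simpa using this

/-- A rescaling is determined by one sign on each class. -/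
lemma card_rescalings_le (hfin : (rescalings c).Finite) :
    Nat.card (rescalings c) ≤ 2 ^ Nat.card (Quotient (rescalingSetoid c)) := by
  classical
  have hinj : Function.Injective fun (r : rescalings c)
      (q : Quotient (rescalingSetoid c)) => decide (r.1 q.out = 1) := by
    rintro ⟨r, hr⟩ ⟨t, ht⟩ h
    refine Subtype.ext (funext fun i => ?_)
    have hi : rescalingSetoid c (⟦i⟧ : Quotient (rescalingSetoid c)).out i := Quotient.mk_out i
    have h1 : (r i = 1) ↔ (t i = 1) := by
      rw [← hi r hr, ← hi t ht]
      exact decide_eq_decide.1 (congrFun h ⟦i⟧)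
    have h2 : ∀ x : kˣ, x * x = 1 → x = 1 ∨ x = -1 := fun x hx => by
      have := mul_self_eq_one_iff.1 (congrArg Units.val hx)
      exact this.imp (fun h => Units.ext h) (fun h => Units.ext h)
    have h3 := h2 _ (mul_self_eq_one_of_mem hfin hr i)
    have h4 := h2 _ (mul_self_eq_one_of_mem hfin ht i)
    change r i = t i
    by_cases h5 : r i = 1
    · rw [h5, h1.1 h5]
    · rw [h3.resolve_left h5, h4.resolve_left fun h' => h5 (h1.2 h')]
  have := Nat.card_le_card_of_injective _ hinj
  rwa [Nat.card_fun, Nat.card_eq_fintype_card (α := Bool), Fintype.card_bool] at this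

/-- If there are many pairs of a permutation and a rescaling that preserve the relations, then
every permutation occurs in such a pair. -/
lemma exists_rescales_of_card (hcard : Nat.card {p : Equiv.Perm (Fin n) × (Fin n → kˣ) //
      Rescales c p.1 p.2} = 2 * n !) :
    (rescalings c).Finite ∧ ∀ σ, ∃ r, Rescales c σ r := by
  classical
  have : Finite {p : Equiv.Perm (Fin n) × (Fin n → kˣ) // Rescales c p.1 p.2} :=
    Nat.finite_of_card_ne_zero (by rw [hcard]; positivity)
  have hfin : (rescalings c).Finite := by
    refine Finite.of_injective (β := {p : Equiv.Perm (Fin n) × (Fin n → kˣ) // Rescales c p.1 p.2})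
      (fun r : rescalings c => ⟨(1, r.1), rescales_one_of_mem r.2⟩) fun r t h => ?_
    simpa [Subtype.ext_iff] using h
  refine ⟨hfin, ?_⟩
  have : Finite (rescalings c) := hfin
  let H := {σ : Equiv.Perm (Fin n) // ∃ r, Rescales c σ r}
  -- Two rescalings that accompany the same permutation differ by an element of `rescalings c`.
  have h1 : 2 * n ! ≤ Nat.card H * Nat.card (rescalings c) := by
    rw [← hcard, ← Nat.card_prod]
    choose ρ hρ using fun σ : H => σ.2
    refine Nat.card_le_card_of_injective (fun p => (⟨⟨p.1.1, p.1.2, p.2⟩,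
      ⟨p.1.2 / ρ ⟨p.1.1, p.1.2, p.2⟩, p.2.div_mem (hρ ⟨p.1.1, p.1.2, p.2⟩)⟩⟩ :
        H × rescalings c)) ?_
    rintro ⟨⟨σ, r⟩, h⟩ ⟨⟨σ', r'⟩, h'⟩ heq
    simp only [Prod.mk.injEq, Subtype.mk.injEq] at heq
    obtain ⟨hσ, heq⟩ := heq
    obtain rfl : σ = σ' := congrArg Subtype.val hσ
    simpa using heq
  have h2 := card_rescalings_le hfin
  have h3 : Nat.card H * (Nat.card (Quotient (rescalingSetoid c)))! ^ 2 ≤ n ! := by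
    have h4 := Setoid.card_perm_mul_factorial_sq_le (rescalingSetoid c) (exists_third hfin)
    rw [Nat.card_fin] at h4
    refine le_trans (Nat.mul_le_mul_right _ ?_) h4
    exact Nat.card_le_card_of_injective (fun σ : H => (⟨σ.1, by
      obtain ⟨r, hr⟩ := σ.2
      exact hr.setoid_iff⟩ : {σ : Equiv.Perm (Fin n) //
        ∀ i j, rescalingSetoid c i j ↔ rescalingSetoid c (σ i) (σ j)}))
      fun σ τ h => Subtype.ext (Subtype.mk.inj h)
  generalize Nat.card (Quotient (rescalingSetoid c)) = d at h2 h3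
  have hd : d ≤ 1 := by
    by_contra! hd
    -- For `d ≥ 2`, the bound `2 ^ (d - 1) ≤ d!` contradicts `2 * d! ^ 2 ≤ 2 ^ d`, which follows
    -- from `h1`, `h2` and `h3`.
    obtain ⟨m, rfl⟩ : ∃ m, d = 1 + (m + 1) := ⟨d - 2, by omega⟩
    have h4 := Nat.factorial_mul_pow_le_factorial (m := 1) (n := m + 1)
    rw [Nat.factorial_one, one_mul] at h4
    have h5 : 2 * n ! * (2 ^ (m + 1)) ^ 2 ≤ n ! * 2 ^ (1 + (m + 1)) := calc
      2 * n ! * (2 ^ (m + 1)) ^ 2 ≤ (Nat.card H * 2 ^ (1 + (m + 1))) * (1 + (m + 1))! ^ 2 := by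
        exact Nat.mul_le_mul (h1.trans (Nat.mul_le_mul_left _ h2)) (Nat.pow_le_pow_left h4 2)
      _ = Nat.card H * (1 + (m + 1))! ^ 2 * 2 ^ (1 + (m + 1)) := by ring
      _ ≤ _ := by gcongr
    have h6 : n ! * 2 ^ (1 + (m + 1)) * 2 ^ (m + 1) ≤ n ! * 2 ^ (1 + (m + 1)) * 1 := by
      rw [mul_one]
      refine le_trans (le_of_eq ?_) h5
      ring
    have h7 := Nat.le_of_mul_le_mul_left h6 (by positivity)
    have h8 : 2 ^ 1 ≤ 2 ^ (m + 1) := Nat.pow_le_pow_right two_pos (by omega)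
    omega
  have h4 : n ! ≤ Nat.card H := by
    have : 2 ^ d ≤ 2 ^ 1 := Nat.pow_le_pow_right two_pos hd
    have h5 := h1.trans (Nat.mul_le_mul_left (Nat.card H) (h2.trans this))
    omega
  have hbij := (Subtype.val_injective (p := fun σ : Equiv.Perm (Fin n) =>
    ∃ r, Rescales c σ r)).bijective_of_nat_card_le (by
      rw [Nat.card_perm, Nat.card_fin]; exact h4)
  intro σ
  obtain ⟨τ, rfl⟩ := hbij.2 σ
  exact τ.2

lemma three_le_of_finite_rescalings (hfin : (rescalings c).Finite) (hn : 0 < n) : 3 ≤ n := by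
  obtain ⟨m, -, hm, -⟩ := exists_third hfin ⟨0, hn⟩ ⟨0, hn⟩
  obtain ⟨l, -, hl, hlm⟩ := exists_third hfin ⟨0, hn⟩ m
  have := m.2
  have := l.2
  simp only [ne_eq, Fin.ext_iff] at hm hl hlm
  omega

/-- Some scalar is nonzero, as otherwise every constant is a rescaling; permutations act
transitively on ordered pairs of distinct indices. -/
lemma ne_zero_of_forall_rescales (hn : 0 < n) (hfin : (rescalings c).Finite)
    (h : ∀ σ, ∃ r, Rescales c σ r) {i j : Fin n} (hij : i ≠ j) : c i j ≠ 0 := by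
  obtain ⟨p, q, hpq, hc⟩ : ∃ p q, p ≠ q ∧ c p q ≠ 0 := by
    by_contra! h0
    exact infinite_of_forall_mem (i := ⟨0, hn⟩) (fun y _ => y)
      (fun y p q hpq hc => absurd (h0 p q hpq) hc) (fun _ => rfl) hfin
  set x := Equiv.swap i p j with hx
  have hxp : p ≠ x := fun h' => hij ((Equiv.swap i p).injective (by
    rw [Equiv.swap_apply_left, ← hx, h']))
  obtain ⟨r, hr⟩ := h (Equiv.swap x q * Equiv.swap i p)
  have := (hr.ne_zero_iff hij).1
  rw [Equiv.Perm.mul_apply, Equiv.Perm.mul_apply, Equiv.swap_apply_left, ← hx,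
    Equiv.swap_apply_left, Equiv.swap_apply_of_ne_of_ne hxp hpq] at this
  exact this hc

-- Take a rescaling `r` that accompanies the transposition of `j` and `l`. The pairs `(i, m)` and
-- `(j, l)` give `r i * r m = 1` and `r j * r l = 1`, and these four factors are what relates the
-- two products.
omit [CharZero k] in
lemma cross_ratio_eq (hsym : ∀ i j, i ≠ j → c i j = c j i) (hne : ∀ i j, i ≠ j → c i j ≠ 0)
    (h : ∀ σ, ∃ r, Rescales c σ r) {i j l m : Fin n} (hij : i ≠ j) (hil : i ≠ l) (him : i ≠ m)
    (hjl : j ≠ l) (hjm : j ≠ m) (hlm : l ≠ m) : c i j * c l m = c i l * c j m := by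
  obtain ⟨r, hr⟩ := h (Equiv.swap j l)
  have h1 := hr i j hij
  have h2 := hr l m hlm
  have h3 := hr i m him
  have h4 := hr j l hjl
  rw [Equiv.swap_apply_of_ne_of_ne hij hil, Equiv.swap_apply_left] at h1
  rw [Equiv.swap_apply_of_ne_of_ne hjm.symm hlm.symm, Equiv.swap_apply_right] at h2
  rw [Equiv.swap_apply_of_ne_of_ne hij hil, Equiv.swap_apply_of_ne_of_ne hjm.symm hlm.symm] at h3
  rw [Equiv.swap_apply_left, Equiv.swap_apply_right, hsym l j hjl.symm] at h4
  have h5 : (r i : k) * r m = 1 := mul_right_cancel₀ (hne i m him) (by rw [h3, one_mul])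
  have h6 : (r j : k) * r l = 1 := mul_right_cancel₀ (hne j l hjl) (by rw [h4, one_mul])
  rw [← h1, ← h2]
  linear_combination (c i l * c j m) * (r j * r l * h5 + h6)

omit [CharZero k] in
/-- A symmetric family that is invariant under all permutations up to rescaling is a rescaling of
the constant family. -/
lemma exists_mul_eq [IsAlgClosed k] (hn : 3 ≤ n) (hsym : ∀ i j, i ≠ j → c i j = c j i)
    (hne : ∀ i j, i ≠ j → c i j ≠ 0) (h : ∀ σ, ∃ r, Rescales c σ r) :
    ∃ s : Fin n → kˣ, ∀ i j, i ≠ j → (s i : k) * s j = c i j := by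
  obtain ⟨o, p, q, hop, hoq, hpq⟩ : ∃ o p q : Fin n, o ≠ p ∧ o ≠ q ∧ p ≠ q :=
    ⟨⟨0, by omega⟩, ⟨1, by omega⟩, ⟨2, by omega⟩, by simp, by simp, by simp⟩
  have h1 := hne o p hop
  have h2 := hne o q hoq
  have h3 := hne p q hpq
  -- If `c i j = s i * s j`, this quotient is `s o ^ 2`; so `z` serves as `s o`, and `c o i / z` as
  -- the other `s i`.
  obtain ⟨z, hz⟩ := IsAlgClosed.exists_eq_mul_self (c o p * c o q / c p q)
  have hz0 : z ≠ 0 := by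
    rintro rfl
    rw [mul_zero, div_eq_zero_iff, mul_eq_zero] at hz
    tauto
  have cross := fun {i j l m : Fin n} => cross_ratio_eq hsym hne h (i := i) (j := j) (l := l)
    (m := m)
  -- The quotient `c o i * c o j / c i j` does not depend on `i` and `j`, by the cross ratio
  -- identity.
  have key : ∀ i j, o ≠ i → o ≠ j → i ≠ j → c o i * c o j * c p q = c i j * (c o p * c o q) := by
    have key1 : ∀ j, o ≠ j → p ≠ j → c o p * c o j * c p q = c p j * (c o p * c o q) := by
      intro j hoj hpj
      rcases eq_or_ne q j with rfl | hqj
      · ring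
      · have := cross hoj hoq hop hqj.symm hpj.symm hpq.symm
        rw [hsym q p hpq.symm, hsym j p hpj.symm] at this
        linear_combination c o p * this
    intro i j hoi hoj hij
    rcases eq_or_ne p i with rfl | hpi
    · exact key1 j hoj hij
    rcases eq_or_ne p j with rfl | hpj
    · rw [mul_comm (c o i), key1 i hoi hij.symm, hsym i p hij]
    · have h4 := key1 j hoj hpj
      have h5 := cross hoi hop hoj hpi.symm hij hpj
      refine mul_left_cancel₀ h1 ?_
      linear_combination c o i * h4 + c o p * c o q * h5
  refine ⟨fun i => if hi : o = i then Units.mk0 z hz0 else Units.mk0 (c o i / z)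
    (div_ne_zero (hne o i hi) hz0), fun i j hij => ?_⟩
  by_cases hi : o = i
  · subst hi
    simp only [dif_pos, dif_neg hij, Units.val_mk0]
    field_simp
  · by_cases hj : o = j
    · subst hj
      simp only [dif_pos, dif_neg hi, Units.val_mk0]
      rw [hsym i o hij]
      field_simp
    · simp only [dif_neg hi, dif_neg hj, Units.val_mk0]
      rw [div_mul_div_comm, ← hz, div_div_eq_mul_div, key i j hi hj hij]
      field_simp

end Rescaling

namespace ModifiedQuantumWeylAlgebra

/-! ### Automorphisms as permutations with rescalings -/

section MonomialEquiv

variable {k : Type*} [Field k] {n : ℕ} {a b : Fin n → Fin n → k}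

/-- The homomorphism that permutes and rescales the generators. -/
noncomputable def monomialHom (σ : Equiv.Perm (Fin n)) (r : Fin n → kˣ)
    (h : ∀ i j, i ≠ j → (r i : k) * r j * sym b (σ i) (σ j) = sym a i j) :
    QuantumWeyl a →ₐ[k] QuantumWeyl b :=
  lift (fun i => (r i : k) • gen b (σ i)) fun i j hij => by
    rw [smul_mul_smul_comm, smul_mul_smul_comm, mul_comm (r j : k), ← smul_add,
      gen_mul_gen_add b (σ.injective.ne hij), ← h i j hij, map_mul (algebraMap k _),
      Algebra.smul_def]

/-- The isomorphism that permutes and rescales the generators. -/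
noncomputable def monomialEquiv (σ : Equiv.Perm (Fin n)) (r : Fin n → kˣ)
    (h : ∀ i j, i ≠ j → (r i : k) * r j * sym b (σ i) (σ j) = sym a i j) :
    QuantumWeyl a ≃ₐ[k] QuantumWeyl b :=
  AlgEquiv.ofAlgHom (monomialHom σ r h)
    (monomialHom σ⁻¹ (fun j => (r (σ⁻¹ j))⁻¹) fun i j hij => by
      rw [← h _ _ (σ⁻¹.injective.ne hij)]
      simp only [Units.val_inv_eq_inv_val, Equiv.Perm.inv_def, Equiv.apply_symm_apply]
      field_simp)
    (algHom_ext fun i => by simp [monomialHom, smul_smul])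
    (algHom_ext fun i => by simp [monomialHom, smul_smul])

@[simp] lemma monomialEquiv_gen (σ : Equiv.Perm (Fin n)) (r : Fin n → kˣ)
    (h : ∀ i j, i ≠ j → (r i : k) * r j * sym b (σ i) (σ j) = sym a i j) (i : Fin n) :
    monomialEquiv σ r h (gen a i) = (r i : k) • gen b (σ i) := by
  simp [monomialEquiv, monomialHom]

lemma smul_gen_inj {i j : Fin n} {r s : kˣ} (h : (r : k) • gen b i = (s : k) • gen b j) :
    i = j ∧ r = s := by
  have := congrArg (normalForm b) h
  rw [map_smul, map_smul, normalForm_gen, normalForm_gen, Finsupp.smul_single, Finsupp.smul_single,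
    Finsupp.single_eq_single_iff] at this
  rcases this with ⟨h1, h2⟩ | ⟨h1, -⟩
  · exact ⟨Finsupp.single_left_injective one_ne_zero h1, Units.ext (by simpa using h2)⟩
  · simp at h1

lemma sym_one (i j : Fin n) : sym (fun _ _ => (1 : k)) i j = 1 := by simp [sym]

variable [CharZero k]

variable (a) in
/-- In an even number of variables, the automorphisms are the permutations and rescalings of the
generators that preserve the relations. -/
lemma card_algEquiv_eq (hn : Even n) : Nat.card (QuantumWeyl a ≃ₐ[k] QuantumWeyl a) =
    Nat.card {p : Equiv.Perm (Fin n) × (Fin n → kˣ) // Rescales (sym a) p.1 p.2} := by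
  symm
  refine Nat.card_congr (Equiv.ofBijective (fun p => monomialEquiv p.1.1 p.1.2 p.2.mul_eq) ⟨?_, ?_⟩)
  · rintro ⟨⟨σ, r⟩, h⟩ ⟨⟨σ', r'⟩, h'⟩ heq
    have h1 : ∀ i, (r i : k) • gen a (σ i) = (r' i : k) • gen a (σ' i) := fun i => by
      simpa only [monomialEquiv_gen] using DFunLike.congr_fun heq (gen a i)
    refine Subtype.ext (Prod.ext (Equiv.ext fun i => ?_) (funext fun i => ?_))
    · exact (smul_gen_inj (h1 i)).1
    · exact (smul_gen_inj (h1 i)).2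
  · intro τ
    obtain ⟨σ, r, h⟩ := exists_perm_of_even a hn τ
    refine ⟨⟨(σ, r), fun i j hij => ?_⟩, algEquiv_ext fun i =>
      (monomialEquiv_gen σ r _ i).trans (h i).symm⟩
    have h1 := congrArg τ (gen_mul_gen_add a hij)
    rw [map_add, map_mul, map_mul, h, h, AlgEquiv.commutes, smul_mul_smul_comm,
      smul_mul_smul_comm, mul_comm (r j : k), ← smul_add, gen_mul_gen_add a (σ.injective.ne hij),
      Algebra.smul_def, ← map_mul] at h1
    exact FaithfulSMul.algebraMap_injective k (QuantumWeyl a) h1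

/-- The signed permutations with constant sign, as automorphisms of the algebra with all the
scalars equal to `1`. -/
noncomputable def signedPermHom (k : Type*) [Field k] (n : ℕ) : Equiv.Perm (Fin n) × ℤˣ →*
    (QuantumWeyl (fun _ _ : Fin n => (1 : k)) ≃ₐ[k] QuantumWeyl (fun _ _ : Fin n => (1 : k))) where
  toFun p := monomialEquiv p.1 (fun _ => Units.map (Int.castRingHom k) p.2) fun i j _ => by
    rw [sym_one, sym_one, ← Units.val_mul, ← map_mul, Int.units_mul_self]
    simp
  map_one' := algEquiv_ext fun i => by simp
  map_mul' p q := algEquiv_ext fun i => by simp [smul_smul, mul_comm]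

lemma signedPermHom_injective (hn : 0 < n) : Function.Injective (signedPermHom k n) := by
  rintro ⟨σ, ε⟩ ⟨σ', ε'⟩ h
  have h1 := fun i => DFunLike.congr_fun h (gen _ i)
  simp only [signedPermHom, MonoidHom.coe_mk, OneHom.coe_mk, monomialEquiv_gen] at h1
  refine Prod.ext (Equiv.ext fun i => (smul_gen_inj (h1 i)).1) ?_
  have h2 := congrArg Units.val (smul_gen_inj (h1 ⟨0, hn⟩)).2
  exact Units.ext (by simpa using h2)

end MonomialEquiv

end ModifiedQuantumWeylAlgebra

/-! ### The main theorem -/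

open ModifiedQuantumWeylAlgebra in
theorem lemma4p1 {k : Type*} [Field k] [IsAlgClosed k] [CharZero k] (n : ℕ) (hn : 2 ≤ n)
    (a : Fin n → Fin n → k)
    (hcard : Nat.card (ModifiedQuantumWeylAlgebra k n a ≃ₐ[k] ModifiedQuantumWeylAlgebra k n a)
      = 2 * n !) :
    Even n ∧ 4 ≤ n ∧
      Nonempty (ModifiedQuantumWeylAlgebra k n a ≃ₐ[k] QuantumWeylAlgebra k n) ∧
      Nonempty ((ModifiedQuantumWeylAlgebra k n a ≃ₐ[k] ModifiedQuantumWeylAlgebra k n a) ≃*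
        Equiv.Perm (Fin n) × ℤˣ) := by
  have hcard' : Nat.card (QuantumWeyl a ≃ₐ[k] QuantumWeyl a) = 2 * n ! := by
    rw [← hcard]
    exact Nat.card_congr (AlgEquiv.autCongr (ofQuantumWeyl a)).toEquiv
  have heven : Even n := by
    by_contra hodd
    have := infinite_algEquiv_of_odd a (Nat.not_even_iff_odd.1 hodd)
    -- An infinite group has `Nat.card` equal to 0, which is not `2 * n !`.
    rw [Nat.card_eq_zero_of_infinite] at hcard'
    have := n.factorial_pos
    omega
  obtain ⟨hfin, hall⟩ := exists_rescales_of_card ((card_algEquiv_eq a heven).symm.trans hcard')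
  have h3 := three_le_of_finite_rescalings hfin (by omega)
  have h4 : 4 ≤ n := by
    obtain ⟨m, rfl⟩ := heven
    omega
  obtain ⟨s, hs⟩ := exists_mul_eq h3 (fun i j => sym_comm a)
    (fun i j => ne_zero_of_forall_rescales (by omega) hfin hall) hall
  let e : QuantumWeyl a ≃ₐ[k] QuantumWeyl (fun _ _ : Fin n => (1 : k)) :=
    monomialEquiv 1 s fun i j hij => by rw [sym_one, mul_one, hs i j hij]
  let e' : ModifiedQuantumWeylAlgebra k n a ≃ₐ[k] QuantumWeyl (fun _ _ : Fin n => (1 : k)) :=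
    (ofQuantumWeyl a).symm.trans e
  refine ⟨heven, h4, ⟨e'.trans (ofQuantumWeyl _)⟩, ?_⟩
  have hcard₁ : Nat.card (QuantumWeyl (fun _ _ : Fin n => (1 : k)) ≃ₐ[k]
      QuantumWeyl (fun _ _ : Fin n => (1 : k))) = 2 * n ! := by
    rw [← hcard]
    exact Nat.card_congr (AlgEquiv.autCongr e').symm.toEquiv
  have : Finite (QuantumWeyl (fun _ _ : Fin n => (1 : k)) ≃ₐ[k]
      QuantumWeyl (fun _ _ : Fin n => (1 : k))) :=
    Nat.finite_of_card_ne_zero (by rw [hcard₁]; positivity)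
  -- The transported automorphism group has exactly as many elements as the embedded group of signed
  -- permutations.
  have hbij : Function.Bijective (signedPermHom k n) :=
    (signedPermHom_injective (by omega)).bijective_of_nat_card_le (by
      rw [hcard₁, Nat.card_prod, Nat.card_perm, Nat.card_fin, Nat.card_eq_fintype_card (α := ℤˣ),
        Fintype.card_units_int, mul_comm])
  exact ⟨(AlgEquiv.autCongr e').trans (MulEquiv.ofBijective _ hbij).symm⟩
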